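/- For $n\ge 1$, a metric on $[n]=\{1,\dots,n\}$ is given by a distance oracle $d$, and for $c\ge 1$ a point $z$ is a $c$-approximate $1$-median if $\sum_x d(z,x)\le c\sum_x d(y,x)$ for every $y\in[n]$. An algorithm for metric $1$-median receives $n$ and has oracle access to $d$; it is $c$-approximate if, for every $n\ge1$ and every metric $d$ on $[n]$, it halts and outputs a $c$-approximate $1$-median of $([n],d)$. Algorithms are deterministic programs of a unit-cost real RAM with integer cells (addition, truncated subtraction, comparison, indirect addressing) and real cells (arithmetic, comparison, indirect addressing), where a query of a distance is one instruction. An algorithm is $O(f(n))$-query (respectively $O(f(n))$-time) if the largest number of queries (respectively of steps) it makes over all metrics on $[n]$ is $O(f(n))$. **Theorem.** For each constant $\varepsilon\in(0,1)$, $$\min\{c\ge 1 \mid \text{metric 1-median has a deterministic } O(n^{1+\varepsilon})\text{-query } c\text{-approximation algorithm}\}$$ $$=\min\{c\ge 1 \mid \text{metric 1-median has a deterministic } O(n^{1+\varepsilon})\text{-time } c\text{-approximation algorithm}\}=2\left\lceil \frac1\varepsilon\right\rceil,$$ and in particular both minima exist. The minimum for queries is the same if algorithms are replaced by arbitrary deterministic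 adaptive query strategies (one decision tree for each $n$, with unrestricted computation between queries). -/

import Mathlib

open Filter Asymptotics

noncomputable section

namespace MetricMedian

/-! ### Metric 1-median -/

/-- `d` is a metric on the `n` points `0, …, n - 1` (a relabelling of `1, …, n`). -/
structure IsMetric {n : ℕ} (d : Fin n → Fin n → ℝ) : Prop where
  nonneg : ∀ x y, 0 ≤ d x y
  self : ∀ x, d x x = 0
  pos : ∀ x y, x ≠ y → 0 < d x y
  symm : ∀ x y, d x y = d y x
  triangle : ∀ x y z, d x z ≤ d x y + d y z

/-- `z` is a `c`-approximate 1-median of `(Fin n, d)`. -/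
def IsApproxMedian {n : ℕ} (c : ℝ) (d : Fin n → Fin n → ℝ) (z : Fin n) : Prop :=
  ∀ y : Fin n, ∑ x, d z x ≤ c * ∑ x, d y x

/-- The distance oracle of `d`. Algorithms name points by natural numbers; a query that does not
name two points is answered by `0`. -/
def oracle {n : ℕ} (d : Fin n → Fin n → ℝ) (a b : ℕ) : ℝ :=
  if h : a < n ∧ b < n then d ⟨a, h.1⟩ ⟨b, h.2⟩ else 0

/-- The number `a` names a point which is a `c`-approximate 1-median. -/
def IsApproxOutput {n : ℕ} (c : ℝ) (d : Fin n → Fin n → ℝ) (a : ℕ) : Prop :=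
  ∃ z : Fin n, (z : ℕ) = a ∧ IsApproxMedian c d z

/-! ### Query strategies: decision trees, with unrestricted computation between queries -/

/-- A deterministic adaptive query strategy: it either outputs a number, or makes a query and
continues depending on the (real) answer. -/
inductive QueryTree : Type where
  | output (z : ℕ) : QueryTree
  | query (a b : ℕ) (next : ℝ → QueryTree) : QueryTree

namespace QueryTree

/-- The output of a strategy with oracle `O`. -/
def run (O : ℕ → ℕ → ℝ) : QueryTree → ℕ
  | output z => z
  | query a b next => run O (next (O a b))

/-- The number of queries that a strategy makes with oracle `O`. -/
def queries (O : ℕ → ℕ → ℝ) : QueryTree → ℕ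
  | output _ => 0
  | query a b next => queries O (next (O a b)) + 1

end QueryTree

/-- The family of strategies `A n`, one for each number `n ≥ 1` of points, is `c`-approximate. -/
def TreesApprox (c : ℝ) (A : ℕ → QueryTree) : Prop :=
  ∀ n : ℕ, 1 ≤ n → ∀ d : Fin n → Fin n → ℝ, IsMetric d →
    IsApproxOutput c d ((A n).run (oracle d))

/-- The family of strategies `A n` makes at most `q n` queries on `n`-point metric spaces. -/
def TreesQueryBound (A : ℕ → QueryTree) (q : ℕ → ℕ) : Prop :=
  ∀ n : ℕ, 1 ≤ n → ∀ d : Fin n → Fin n → ℝ, IsMetric d → (A n).queries (oracle d) ≤ q n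

/-! ### Algorithms: programs of a unit-cost real RAM with a distance oracle

The memory consists of integer cells `w 0, w 1, …` holding natural numbers and real cells
`x 0, x 1, …`. Integers can be added, subtracted, compared and used as addresses; reals can be
added, subtracted, multiplied, divided and compared. There is no conversion of reals to
integers. -/

/-- Basic instructions. -/
inductive Instr : Type where
  /-- `w r := k` -/
  | const (r k : ℕ)
  /-- `w r := w a + w b` -/
  | add (r a b : ℕ)
  /-- `w r := max (w a - w b) 0` -/
  | sub (r a b : ℕ)
  /-- `w r := w (w a)` -/
  | load (r a : ℕ)
  /-- `w (w r) := w a` -/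
  | store (r a : ℕ)
  /-- `x r := w a` -/
  | cast (r a : ℕ)
  /-- `x r := x a + x b` -/
  | radd (r a b : ℕ)
  /-- `x r := x a - x b` -/
  | rsub (r a b : ℕ)
  /-- `x r := x a * x b` -/
  | rmul (r a b : ℕ)
  /-- `x r := x a / x b` (which is `0` if `x b = 0`) -/
  | rdiv (r a b : ℕ)
  /-- `x r := x (w a)` -/
  | rload (r a : ℕ)
  /-- `x (w r) := x a` -/
  | rstore (r a : ℕ)
  /-- `x r :=` the answer of the oracle to the query `(w a, w b)` -/
  | query (r a b : ℕ)

/-- Tests that control branching and looping. -/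
inductive Cond : Type where
  /-- `w a < w b` -/
  | lt (a b : ℕ)
  /-- `x a < x b` -/
  | rlt (a b : ℕ)

/-- Programs. -/
inductive Prog : Type where
  | skip : Prog
  | instr (i : Instr) : Prog
  | seq (p q : Prog) : Prog
  | ite (t : Cond) (p q : Prog) : Prog
  /-- while `t` holds, do `p` -/
  | loop (t : Cond) (p : Prog) : Prog

/-- The memory, with a counter of the queries made so far (which programs cannot read). -/
structure Store : Type where
  w : ℕ → ℕ
  x : ℕ → ℝ
  queries : ℕ

/-- A configuration: the programs still to be executed, one after the other, and the memory. -/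
structure Config : Type where
  todo : List Prog
  store : Store

/-- Execution of a basic instruction. -/
def Instr.exec (O : ℕ → ℕ → ℝ) (s : Store) : Instr → Store
  | .const r k => { s with w := Function.update s.w r k }
  | .add r a b => { s with w := Function.update s.w r (s.w a + s.w b) }
  | .sub r a b => { s with w := Function.update s.w r (s.w a - s.w b) }
  | .load r a => { s with w := Function.update s.w r (s.w (s.w a)) }
  | .store r a => { s with w := Function.update s.w (s.w r) (s.w a) }
  | .cast r a => { s with x := Function.update s.x r (s.w a : ℝ) }
  | .radd r a b => { s with x := Function.update s.x r (s.x a + s.x b) }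
  | .rsub r a b => { s with x := Function.update s.x r (s.x a - s.x b) }
  | .rmul r a b => { s with x := Function.update s.x r (s.x a * s.x b) }
  | .rdiv r a b => { s with x := Function.update s.x r (s.x a / s.x b) }
  | .rload r a => { s with x := Function.update s.x r (s.x (s.w a)) }
  | .rstore r a => { s with x := Function.update s.x (s.w r) (s.x a) }
  | .query r a b =>
      { s with x := Function.update s.x r (O (s.w a) (s.w b)), queries := s.queries + 1 }

/-- The test `t` succeeds in memory `s`. -/
def Cond.Holds (s : Store) : Cond → Prop
  | .lt a b => s.w a < s.w b
  | .rlt a b => s.x a < s.x b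

open Classical in
/-- One step of computation; a configuration with nothing left to do has halted. -/
def step (O : ℕ → ℕ → ℝ) : Config → Config
  | ⟨[], s⟩ => ⟨[], s⟩
  | ⟨.skip :: k, s⟩ => ⟨k, s⟩
  | ⟨.instr i :: k, s⟩ => ⟨k, i.exec O s⟩
  | ⟨.seq p q :: k, s⟩ => ⟨p :: q :: k, s⟩
  | ⟨.ite t p q :: k, s⟩ => if t.Holds s then ⟨p :: k, s⟩ else ⟨q :: k, s⟩
  | ⟨.loop t p :: k, s⟩ => if t.Holds s then ⟨p :: .loop t p :: k, s⟩ else ⟨k, s⟩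

/-- The initial configuration: `w 0` holds `n`, and all other cells hold `0`. -/
def init (A : Prog) (n : ℕ) : Config :=
  ⟨[A], ⟨Function.update (fun _ => 0) 0 n, fun _ => 0, 0⟩⟩

/-- The configuration after `t` steps of `A` on input `n` with oracle `O`. -/
def after (A : Prog) (n : ℕ) (O : ℕ → ℕ → ℝ) (t : ℕ) : Config :=
  (step O)^[t] (init A n)

/-- On input `n` with oracle `O`, `A` has halted after at most `t` steps. -/
def HaltedBy (A : Prog) (n : ℕ) (O : ℕ → ℕ → ℝ) (t : ℕ) : Prop :=
  (after A n O t).todo = []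

/-- The program `A` is `c`-approximate: on every finite metric space with at least one point it
halts and `w 0` then holds a `c`-approximate 1-median. -/
def ProgApprox (c : ℝ) (A : Prog) : Prop :=
  ∀ n : ℕ, 1 ≤ n → ∀ d : Fin n → Fin n → ℝ, IsMetric d →
    ∃ t, HaltedBy A n (oracle d) t ∧ IsApproxOutput c d ((after A n (oracle d) t).store.w 0)

/-- `A` makes at most `q n` queries on `n`-point metric spaces. -/
def ProgQueryBound (A : Prog) (q : ℕ → ℕ) : Prop :=
  ∀ n : ℕ, 1 ≤ n → ∀ d : Fin n → Fin n → ℝ, IsMetric d →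
    ∀ t, (after A n (oracle d) t).store.queries ≤ q n

/-- `A` halts within `T n` steps on `n`-point metric spaces. -/
def ProgTimeBound (A : Prog) (T : ℕ → ℕ) : Prop :=
  ∀ n : ℕ, 1 ≤ n → ∀ d : Fin n → Fin n → ℝ, IsMetric d → HaltedBy A n (oracle d) (T n)

/-! ### The complexity bounds -/

/-- `q n = O(n ^ e)`. -/
def IsBigOPow (q : ℕ → ℕ) (e : ℝ) : Prop :=
  (fun n : ℕ => (q n : ℝ)) =O[atTop] (fun n : ℕ => (n : ℝ) ^ e)

/-- Metric 1-median has a deterministic `O(n ^ e)`-query `c`-approximation strategy. -/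
def HasQueryStrategy (e c : ℝ) : Prop :=
  ∃ (A : ℕ → QueryTree) (q : ℕ → ℕ), TreesApprox c A ∧ TreesQueryBound A q ∧ IsBigOPow q e

/-- Metric 1-median has a deterministic `O(n ^ e)`-query `c`-approximation algorithm. -/
def HasQueryAlgorithm (e c : ℝ) : Prop :=
  ∃ (A : Prog) (q : ℕ → ℕ), ProgApprox c A ∧ ProgQueryBound A q ∧ IsBigOPow q e

/-- Metric 1-median has a deterministic `O(n ^ e)`-time `c`-approximation algorithm. -/
def HasTimeAlgorithm (e c : ℝ) : Prop :=
  ∃ (A : Prog) (T : ℕ → ℕ), ProgApprox c A ∧ ProgTimeBound A T ∧ IsBigOPow T e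

end MetricMedian

end

/-! Upper bound. Cut at most `b ^ h` points into `b` blocks, recurse inside them, and keep the
candidate that is cheapest for the whole. If `m` is a 2i-approximate median of a subblock S of a
block X, then |S| d(y, m) ≤ (2i + 1) cost_S(y) and cost_X(m) ≤ |X| d(y, m) + cost_X(y) for every y.
Weighting by |S| and summing over the subblocks bounds the cheapest candidate by (2i + 2) cost_X(y)
(`IsPseudoOracle.cost_step`, `blockProg_exec`). Each level adds 2 to the ratio and about bn to the
time, so h = ⌈1/ε⌉ levels suffice.

Lower bound. Let g = ⌈1/ε⌉ - 1, so that εg < 1, and choose ε < β < 1/g. An adversary answers with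
twice the hop distance, capped at 2g + 2, in a graph that it builds with degrees at most D ≈ n^β.
Balls of radius g have o(n) points, and O(n^(1+ε)) edges exhaust the degree of only o(n) points. An
answer is safe from later edges as soon as no detour through points that can still get edges would
be shorter (`hop_insert`). A small reserve of points pretends to be far from everything. At the end,
a reserve point y about which little was asked, other than the output z, is declared to be at
distance 1 from almost all points, while z stays at distance 2g + 2 from almost all points. This
contradicts no answer (`Settled.finalDist_eq`) and forces a ratio of 2g + 2 - o(1)
(`exists_metric_of_queries_le`).

A program unfolds into decision trees (`exists_tree`), so the bound for trees serves all three
minima. -/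

open Filter Asymptotics

noncomputable section

namespace MetricMedian

section

/-! ### Timed execution of programs -/

/-- Started in memory `s`, the program `p` ends after at most `T` steps in a memory satisfying
`Q`. -/
def Exec (O : ℕ → ℕ → ℝ) (p : Prog) (T : ℕ) (s : Store) (Q : Store → Prop) : Prop :=
  ∃ t ≤ T, ∃ s', (∀ k, (step O)^[t] ⟨p :: k, s⟩ = ⟨k, s'⟩) ∧ Q s'

variable {O : ℕ → ℕ → ℝ} {p q : Prog} {s : Store} {Q Q' : Store → Prop} {T T' : ℕ}

lemma Exec.mono (H : Exec O p T s Q) (hT : T ≤ T') (hQ : ∀ s', Q s' → Q' s') :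
    Exec O p T' s Q' := by
  obtain ⟨t, ht, s', h, hs⟩ := H
  exact ⟨t, ht.trans hT, s', h, hQ _ hs⟩

lemma Exec.instr {i : Instr} (H : Q (i.exec O s)) : Exec O (.instr i) 1 s Q :=
  ⟨1, le_rfl, _, fun _ => rfl, H⟩

lemma Exec.skip (H : Q s) : Exec O .skip 1 s Q :=
  ⟨1, le_rfl, _, fun _ => rfl, H⟩

lemma Exec.seq (H : Exec O p T s fun s' => Exec O q T' s' Q) :
    Exec O (.seq p q) (T + T' + 1) s Q := by
  obtain ⟨t, ht, s', h, t', ht', s'', h', hs⟩ := H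
  refine ⟨t' + (t + 1), by omega, s'', fun k => ?_, hs⟩
  rw [Function.iterate_add_apply, Function.iterate_succ_apply]
  simp only [step, h, h']

lemma Exec.instr_seq {i : Instr} (H : Exec O q T (i.exec O s) Q) :
    Exec O (.seq (.instr i) q) (T + 2) s Q :=
  (Exec.seq (Exec.instr H)).mono (by omega) fun _ h => h

lemma Exec.ite {c : Cond} (Hp : c.Holds s → Exec O p T s Q) (Hq : ¬ c.Holds s → Exec O q T s Q) :
    Exec O (.ite c p q) (T + 1) s Q := by
  by_cases hc : c.Holds s
  · obtain ⟨t, ht, s', h, hs⟩ := Hp hc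
    refine ⟨t + 1, by omega, s', fun k => ?_, hs⟩
    rw [Function.iterate_succ_apply]
    simp only [step, if_pos hc, h]
  · obtain ⟨t, ht, s', h, hs⟩ := Hq hc
    refine ⟨t + 1, by omega, s', fun k => ?_, hs⟩
    rw [Function.iterate_succ_apply]
    simp only [step, if_neg hc, h]

/-- A loop with an invariant `I` that is indexed by an upper bound on the number of rounds. -/
lemma Exec.loop {c : Cond} {C : ℕ} (I : ℕ → Store → Prop)
    (body : ∀ m s, I m s → c.Holds s → Exec O p C s fun s' => ∃ m' < m, I m' s')
    (post : ∀ m s, I m s → ¬ c.Holds s → Q s) (m : ℕ) (hI : I m s) :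
    Exec O (.loop c p) (m * (C + 1) + 1) s Q := by
  induction m using Nat.strong_induction_on generalizing s with
  | _ m ih =>
    by_cases hc : c.Holds s
    · obtain ⟨t, ht, s', h, m', hm', hI'⟩ := body m s hI hc
      obtain ⟨t', ht', s'', h', hs⟩ := ih m' hm' hI'
      refine ⟨t' + (t + 1), ?_, s'', fun k => ?_, hs⟩
      · have : (m' + 1) * (C + 1) ≤ m * (C + 1) := Nat.mul_le_mul_right _ hm'
        rw [Nat.add_mul] at this
        omega
      · rw [Function.iterate_add_apply, Function.iterate_succ_apply]
        simp only [step, if_pos hc, h, h']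
    · refine ⟨1, by omega, s, fun k => ?_, post m s hI hc⟩
      simp [step, if_neg hc]

lemma step_iterate_nil (t : ℕ) : (step O)^[t] ⟨[], s⟩ = ⟨[], s⟩ :=
  Function.iterate_fixed rfl t

/-! ### The program -/

/-- `x 0 :=` the sum of the distances from `w 4` to the points in `[w a, w e)`. -/
def costProg (a e : ℕ) : Prog :=
  .seq (.instr (.rsub 0 2 2)) <| .seq (.instr (.add 5 a 6)) <|
  .loop (.lt 5 e) <| .seq (.instr (.query 1 4 5)) <| .seq (.instr (.radd 0 0 1)) <|
  .instr (.add 5 5 1)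

lemma costProg_exec {a e l : ℕ} (he : e ≠ 5) (h1 : s.w 1 = 1) (h6 : s.w 6 = 0)
    (hl : s.w a + l = s.w e) :
    Exec O (costProg a e) (6 * l + 5) s fun s' =>
      s'.x 0 = ∑ y ∈ Finset.Ico (s.w a) (s.w e), O (s.w 4) y ∧
      (∀ r, r ≠ 5 → s'.w r = s.w r) ∧ ∀ r, 2 ≤ r → s'.x r = s.x r := by
  refine (Exec.instr_seq <| Exec.instr_seq <| Exec.loop (C := 5) (fun m s' => ∃ v, v + m = s.w e ∧
    s.w a ≤ v ∧ s'.w 5 = v ∧ s'.x 0 = ∑ y ∈ Finset.Ico (s.w a) v, O (s.w 4) y ∧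
      (∀ r, r ≠ 5 → s'.w r = s.w r) ∧ ∀ r, 2 ≤ r → s'.x r = s.x r) ?_ ?_ l ?_).mono
      (by omega) fun _ h => h
  · rintro m s' ⟨v, hv, hav, h5, h0, hw, hx⟩ hc
    simp only [Cond.Holds, h5, hw e he] at hc
    refine Exec.instr_seq <| Exec.instr_seq <| Exec.instr ⟨m - 1, by omega, v + 1, by omega,
      by omega, ?_, ?_, ?_, ?_⟩
    · simp [Instr.exec, h5, hw, h1]
    · rw [Finset.sum_Ico_succ_top hav, ← h0]
      simp [Instr.exec, h5, hw]
    · intro r hr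
      simp [Instr.exec, hr, hw]
    · intro r hr
      have h0 : r ≠ 0 := by omega
      have h1 : r ≠ 1 := by omega
      simp [Instr.exec, h0, h1, hx r hr]
  · rintro m s' ⟨v, hv, hav, h5, h0, hw, hx⟩ hc
    simp only [Cond.Holds, h5, hw e he] at hc
    obtain rfl : v = s.w e := by omega
    exact ⟨h0, hw, hx⟩
  · refine ⟨s.w a, hl, le_rfl, ?_, ?_, ?_, ?_⟩
    · simp [Instr.exec, h6]
    · simp [Instr.exec]
    · intro r hr
      simp [Instr.exec, hr]
    · intro r hr
      have h0 : r ≠ 0 := by omega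
      simp [Instr.exec, h0]

/-- `w (13 + 4 * i) :=` an approximate 1-median of the block of at most `(w 3) ^ i` points that
starts at `w 2`, and `w 2 :=` the end of this block. -/
def blockProg : ℕ → Prog
  | 0 => .seq (.instr (.add 13 2 6)) (.instr (.add 2 2 1))
  | i + 1 =>
    -- Each level has its own cells, which recursive calls leave alone: the ends of the block, the
    -- best candidate (which is the result cell of the level) and its cost `x (11 + i)`. Adding `w
    -- 6` or `x 2`, which are always 0, copies a cell.
    .seq (.instr (.add (15 + 4 * i) 2 6)) <|
    .seq (.instr (.add (16 + 4 * i) 2 (14 + 4 * i))) <|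
    .seq (.ite (.lt 0 (16 + 4 * i)) (.instr (.add (16 + 4 * i) 0 6)) .skip) <|
    .seq (.instr (.add 4 2 6)) <|
    .seq (costProg (15 + 4 * i) (16 + 4 * i)) <|
    .seq (.instr (.radd (11 + i) 0 2)) <|
    .seq (.instr (.add (17 + 4 * i) 4 6)) <|
    .loop (.lt 2 (16 + 4 * i)) <|
      .seq (blockProg i) <|
      .seq (.instr (.add 4 (13 + 4 * i) 6)) <|
      .seq (costProg (15 + 4 * i) (16 + 4 * i)) <|
      .ite (.rlt 0 (11 + i))
        (.seq (.instr (.radd (11 + i) 0 2)) (.instr (.add (17 + 4 * i) 4 6))) .skip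

/-! ### Averaging over subblocks -/

/-- `m` is an approximate 1-median of the points in `[a, e)` among the points in `[0, n)`. -/
def IsBlockMedian (O : ℕ → ℕ → ℝ) (n i a e m : ℕ) : Prop :=
  m < n ∧ ∀ y < n, ∑ x ∈ Finset.Ico a e, O m x ≤ 2 * i * ∑ x ∈ Finset.Ico a e, O y x

/-- `O` answers queries about points in `[0, n)` as a pseudometric does. -/
structure IsPseudoOracle (O : ℕ → ℕ → ℝ) (n : ℕ) : Prop where
  nonneg : ∀ x < n, ∀ y < n, 0 ≤ O x y
  self : ∀ x < n, O x x = 0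
  symm : ∀ x < n, ∀ y < n, O x y = O y x
  triangle : ∀ x < n, ∀ y < n, ∀ z < n, O x z ≤ O x y + O y z

/-- The best of a number of candidates is at most as costly as their weighted average. This is the
step of the averaging in which the median `m` of the subblock `[a', e')` is a candidate. -/
lemma IsPseudoOracle.cost_step {n : ℕ} (hO : IsPseudoOracle O n) {i a e a' e' m y : ℕ} {B : ℝ}
    (hm : IsBlockMedian O n i a' e' m) (hy : y < n) (hae : a ≤ e) (hae' : a' ≤ e') (hen : e ≤ n)
    (hen' : e' ≤ n) (hB : B ≤ ∑ x ∈ Finset.Ico a e, O m x) :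
    ((e' : ℝ) - a') * B ≤ (e' - a') * ∑ x ∈ Finset.Ico a e, O y x +
      (e - a) * ((2 * i + 1) * ∑ x ∈ Finset.Ico a' e', O y x) := by
  have h1 : ∑ x ∈ Finset.Ico a e, O m x ≤ (e - a) * O y m + ∑ x ∈ Finset.Ico a e, O y x := by
    have : ∑ x ∈ Finset.Ico a e, O m x ≤ ∑ x ∈ Finset.Ico a e, (O y m + O y x) := by
      refine Finset.sum_le_sum fun x hx => ?_
      have hx := (Finset.mem_Ico.1 hx).2.trans_le hen
      rw [hO.symm y hy m hm.1]
      exact hO.triangle _ hm.1 _ hy _ hx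
    rw [Finset.sum_add_distrib] at this
    simpa [Nat.cast_sub hae] using this
  have h2 : ((e' : ℝ) - a') * O y m ≤ (2 * i + 1) * ∑ x ∈ Finset.Ico a' e', O y x := by
    have : ∑ x ∈ Finset.Ico a' e', O y m ≤ ∑ x ∈ Finset.Ico a' e', (O y x + O m x) := by
      refine Finset.sum_le_sum fun x hx => ?_
      have hx := (Finset.mem_Ico.1 hx).2.trans_le hen'
      rw [hO.symm m hm.1 x hx]
      exact hO.triangle _ hy _ hx _ hm.1
    rw [Finset.sum_add_distrib] at this
    have h3 := hm.2 y hy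
    simp [Nat.cast_sub hae'] at this
    linarith
  have hae : (a : ℝ) ≤ e := by exact_mod_cast hae
  have hae' : (a' : ℝ) ≤ e' := by exact_mod_cast hae'
  have h3 := mul_le_mul_of_nonneg_left (hB.trans h1) (sub_nonneg.2 hae')
  have h4 := mul_le_mul_of_nonneg_left h2 (sub_nonneg.2 hae)
  linarith

/-- The cells that `blockProg i` leaves alone are the same in `s'` as in `s`. -/
def BlockFrame (i : ℕ) (s s' : Store) : Prop :=
  (∀ r, r ≠ 2 → r ≠ 4 → r ≠ 5 → (r < 10 ∨ 14 + 4 * i ≤ r ∨ r % 4 = 2) → s'.w r = s.w r) ∧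
  ∀ r, (r = 2 ∨ 11 + i ≤ r) → s'.x r = s.x r

/-- The invariant of the loop over the subblocks: `m` rounds are left. -/
def BlockInv (O : ℕ → ℕ → ℝ) (n b i p e : ℕ) (s : Store) (m : ℕ) (s' : Store) : Prop :=
  ∃ k, k + m = b ∧ s'.w 2 = min (p + k * b ^ i) n ∧ s'.w (15 + 4 * i) = p ∧
    s'.w (16 + 4 * i) = e ∧ s'.w (17 + 4 * i) < n ∧
    s'.x (11 + i) = ∑ x ∈ Finset.Ico p e, O (s'.w (17 + 4 * i)) x ∧
    (∀ y < n, ((min (p + k * b ^ i) n : ℕ) - p : ℝ) * s'.x (11 + i) ≤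
      ((min (p + k * b ^ i) n : ℕ) - p : ℝ) * ∑ x ∈ Finset.Ico p e, O y x +
      (e - p) * ((2 * i + 1) * ∑ x ∈ Finset.Ico p (min (p + k * b ^ i) n), O y x)) ∧
    BlockFrame (i + 1) s s'

/-- The loop invariant is the averaged inequality for the subblocks treated so far, weighted by
their total length. After the last round this weight is the full length `e - p`; it cancels and
leaves the ratio 1 + (2i + 1) = 2(i + 1). Each of at most `b` rounds costs one recursive call and
one scan of the block. -/
lemma blockProg_exec {n b : ℕ} (hO : IsPseudoOracle O n) (hb : 1 ≤ b) (i : ℕ) :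
    ∀ (s : Store) (p : ℕ), s.w 0 = n → s.w 1 = 1 → s.w 6 = 0 →
    (∀ j ≤ i, s.w (10 + 4 * j) = b ^ j) → s.x 2 = 0 → s.w 2 = p → p < n →
    Exec O (blockProg i) (100 * (i + 1) * b ^ (i + 1)) s fun s' =>
      s'.w 2 = min (p + b ^ i) n ∧
      IsBlockMedian O n i p (min (p + b ^ i) n) (s'.w (13 + 4 * i)) ∧ BlockFrame i s s' := by
  induction i with
  | zero =>
    intro s p h0 h1 h6 hG hx hp hpn
    refine (Exec.instr_seq <| Exec.instr ⟨?_, ⟨?_, ?_⟩, ?_, ?_⟩).mono (T := 3) (by simp; omega)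
      fun _ h => h
    · have : min (p + b ^ 0) n = p + 1 := by rw [pow_zero]; omega
      rw [this]
      simp [Instr.exec, hp, h1]
    · simp [Instr.exec, hp, h6, hpn]
    · have : min (p + b ^ 0) n = p + 1 := by rw [pow_zero]; omega
      rw [this]
      simp [Instr.exec, hp, h6, hO.self p hpn]
    · intro r h2 h4 h5 hr
      have : r ≠ 13 := by omega
      simp [Instr.exec, h2, this]
    · simp [Instr.exec]
  | succ i ih =>
    intro s p h0 h1 h6 hG hx hp hpn
    obtain ⟨e, he⟩ : ∃ e, e = min (p + b ^ (i + 1)) n := ⟨_, rfl⟩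
    have hbi : 0 < b ^ i := Nat.pow_pos hb
    have hbi' : 0 < b ^ (i + 1) := Nat.pow_pos hb
    have hpe : p < e := by omega
    have hlen : e - p ≤ b ^ (i + 1) := by omega
    rw [← he]
    have hG' := hG (i + 1) le_rfl
    rw [show 10 + 4 * (i + 1) = 14 + 4 * i by ring] at hG'
    rw [blockProg, show 13 + 4 * (i + 1) = 17 + 4 * i by ring]
    obtain ⟨C, hC⟩ : ∃ C, C = 100 * (i + 1) * b ^ (i + 1) + 20 + 6 * b ^ (i + 1) := ⟨_, rfl⟩
    refine (Exec.instr_seq <| Exec.instr_seq <|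
      Exec.seq (T' := 6 * b ^ (i + 1) + 20 + b * (C + 1)) <| (Exec.ite (T := 1)
      (Q := fun s1 => s1.w (15 + 4 * i) = p ∧ s1.w (16 + 4 * i) = e ∧
        (∀ r, r ≠ 15 + 4 * i → r ≠ 16 + 4 * i → s1.w r = s.w r) ∧ s1.x = s.x)
      (fun hc => Exec.instr ?_) (fun hc => Exec.skip ?_)).mono le_rfl ?_).mono ?_ fun _ h => h
    · simp (disch := omega) only [Cond.Holds, Instr.exec, Function.update_self,
        Function.update_of_ne, h0, h6, hp, hG'] at hc ⊢
      refine ⟨rfl, by omega, fun r hr hr' => ?_, trivial⟩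
      simp (disch := omega) only [Function.update_of_ne]
    · simp (disch := omega) only [Cond.Holds, Instr.exec, Function.update_self,
        Function.update_of_ne, h0, h6, hp, hG'] at hc ⊢
      refine ⟨rfl, by omega, fun r hr hr' => ?_, trivial⟩
      simp (disch := omega) only [Function.update_of_ne]
    · rintro s1 ⟨ha, hee, hw, hx1⟩
      refine (Exec.instr_seq <| Exec.seq (T' := 5 + b * (C + 1)) <|
        (costProg_exec (l := e - p) (by omega) ?_ ?_ ?_).mono (T' := 6 * b ^ (i + 1) + 5)
        (by omega) ?_).mono (by omega) fun _ h => h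
      · simp (disch := omega) only [Instr.exec, Function.update_of_ne, hw, h1]
      · simp (disch := omega) only [Instr.exec, Function.update_of_ne, hw, h6]
      · simp (disch := omega) only [Instr.exec, Function.update_of_ne, ha, hee]
        omega
      simp (disch := omega) only [Instr.exec, Function.update_of_ne, Function.update_self, ha, hee,
        hw, hx1, hp, h6]
      rintro s2 ⟨hc2, hw2, hx2⟩
      refine (Exec.instr_seq <| Exec.instr_seq <| Exec.loop (C := C)
        (BlockInv O n b i p e s) ?_ ?_ b ?_).mono (by omega) fun _ h => h
      · clear hc2 hw2 hx2 s2 ha hee hw hx1 s1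
        rintro m s' ⟨k, hk, h2, ha, hee, hR, hB, hinv, hw, hx'⟩ hc
        simp only [Cond.Holds, h2, hee] at hc
        have hkb : k < b := by
          by_contra hkb
          have := Nat.mul_le_mul_right (b ^ i) (not_lt.1 hkb)
          rw [← pow_succ'] at this
          omega
        have hP : min (p + k * b ^ i) n = p + k * b ^ i := by omega
        rw [hP] at h2 hinv
        refine (Exec.seq (T' := 14 + 6 * b ^ (i + 1)) <| (ih s' (p + k * b ^ i) ?_ ?_ ?_
          (fun j hj => ?_) ?_ h2 (by omega)).mono le_rfl ?_).mono ?_ fun _ h => h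
        · rw [hw _ (by omega) (by omega) (by omega) (by omega), h0]
        · rw [hw _ (by omega) (by omega) (by omega) (by omega), h1]
        · rw [hw _ (by omega) (by omega) (by omega) (by omega), h6]
        · rw [hw _ (by omega) (by omega) (by omega) (by omega), hG _ (by omega)]
        · rw [hx' _ (by omega), hx]
        swap
        · rw [hC]; omega
        rintro s3 ⟨h23, hm, hw3, hx3⟩
        refine (Exec.instr_seq <| Exec.seq (T' := 5) <|
          (costProg_exec (l := e - p) (by omega) ?_ ?_ ?_).mono (T' := 6 * b ^ (i + 1) + 5)
          (by omega) ?_).mono (by omega) fun _ h => h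
        · simp (disch := omega) only [Instr.exec, Function.update_of_ne, hw3, hw, h1]
        · simp (disch := omega) only [Instr.exec, Function.update_of_ne, hw3, hw, h6]
        · simp (disch := omega) only [Instr.exec, Function.update_of_ne, hw3, ha, hee]
          omega
        simp (disch := omega) only [Instr.exec, Function.update_of_ne, Function.update_self, hw3,
          hw, h6, ha, hee, Nat.add_zero]
        rintro s4 ⟨h4, hw4, hx4⟩
        set P' := min (p + k * b ^ i + b ^ i) n with hP'
        have hk1 : min (p + (k + 1) * b ^ i) n = P' := by rw [hP', add_one_mul, add_assoc]
        -- Whichever candidate is kept, its cost is at most both the old best cost and the new one.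
        -- The old weight is handled by the invariant, the weight of the new subblock by
        -- `cost_step`.
        have key : ∀ B ≤ s'.x (11 + i), B ≤ s4.x 0 → ∀ y < n,
            ((P' : ℕ) - p : ℝ) * B ≤ ((P' : ℕ) - p : ℝ) * ∑ x ∈ Finset.Ico p e, O y x +
            (e - p) * ((2 * i + 1) * ∑ x ∈ Finset.Ico p P', O y x) := by
          intro B hBB hB4 y hy
          have h5 := hO.cost_step hm hy hpe.le (by omega) (by omega) (by omega) (hB4.trans h4.le)
          have h6 := hinv y hy
          rw [← Finset.sum_Ico_consecutive (fun x => O y x) (Nat.le_add_right p (k * b ^ i))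
            (by omega : p + k * b ^ i ≤ P')]
          have h7 := mul_le_mul_of_nonneg_left hBB
            (by push_cast; simp; positivity : (0 : ℝ) ≤ (p + k * b ^ i : ℕ) - p)
          linarith
        have frame : BlockFrame (i + 1) s s4 := by
          refine ⟨fun r hr2 hr4 hr5 hr => ?_, fun r hr => ?_⟩
          · simp (disch := omega) only [Function.update_of_ne, hw4, hw3, hw]
          · simp (disch := omega) only [hx4, hx3, hx']
        refine (Exec.ite (T := 4) (fun hc => (Exec.instr_seq <| Exec.instr
          ⟨m - 1, by omega, k + 1, by omega, ?_, ?_, ?_, ?_, ?_, ?_, ?_, ?_⟩).mono (by omega)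
          fun _ h => h) (fun hc => (Exec.skip
          ⟨m - 1, by omega, k + 1, by omega, ?_, ?_, ?_, ?_, ?_, ?_, frame⟩).mono (by omega)
          fun _ h => h))
        · simp (disch := omega) only [Instr.exec, Function.update_of_ne, hw4, h23, hk1]
        · simp (disch := omega) only [Instr.exec, Function.update_of_ne, hw4, hw3, ha]
        · simp (disch := omega) only [Instr.exec, Function.update_of_ne, hw4, hw3, hee]
        · simp (disch := omega) only [Instr.exec, Function.update_of_ne, Function.update_self,
            hw4, hw3, hw, h6, Nat.add_zero, hm.1]
        · simp (disch := omega) only [Instr.exec, Function.update_of_ne, Function.update_self,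
            hw4, hw3, hw, h6, h4, hx4, hx3, hx', hx, add_zero]
        · rw [hk1]
          simp (disch := omega) only [Cond.Holds, Instr.exec, Function.update_self, hx4, hx3, hx',
            hx, add_zero] at hc ⊢
          exact key _ hc.le le_rfl
        · intro r hr2 hr4 hr5 hr
          rw [← frame.1 r hr2 hr4 hr5 hr]
          simp (disch := omega) only [Instr.exec, Function.update_of_ne]
        · intro r hr
          rw [← frame.2 r hr]
          simp (disch := omega) only [Instr.exec, Function.update_of_ne]
        · simp (disch := omega) only [Function.update_of_ne, hw4, h23, hk1]
        · simp (disch := omega) only [Function.update_of_ne, hw4, hw3, ha]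
        · simp (disch := omega) only [Function.update_of_ne, hw4, hw3, hee]
        · simp (disch := omega) only [Function.update_of_ne, hw4, hw3, hR]
        · simp (disch := omega) only [Function.update_of_ne, hw4, hw3, hx4, hx3, hB]
        · rw [hk1]
          simp only [Cond.Holds, not_lt] at hc
          simp (disch := omega) only [hx4, hx3] at hc ⊢
          exact key _ le_rfl hc
      · rintro m s' ⟨k, hk, h2, ha, hee, hR, hB, hinv, hw, hx'⟩ hc
        simp only [Cond.Holds, h2, hee] at hc
        have hkb : k * b ^ i ≤ b ^ (i + 1) := by
          rw [pow_succ']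
          exact Nat.mul_le_mul_right (b ^ i) (by omega)
        have hP : min (p + k * b ^ i) n = e := by omega
        rw [hP] at h2 hinv
        refine ⟨h2, ⟨hR, fun y hy => ?_⟩, hw, hx'⟩
        have hpos : (0 : ℝ) < e - p := sub_pos.2 (by exact_mod_cast hpe)
        rw [← hB]
        refine le_of_mul_le_mul_left ((hinv y hy).trans (le_of_eq ?_)) hpos
        push_cast
        ring
      · refine ⟨0, by omega, ?_, ?_, ?_, ?_, ?_, ?_, ?_, ?_⟩
        · simp (disch := omega) only [Instr.exec, Function.update_of_ne, hw2, hw, hp]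
          omega
        · simp (disch := omega) only [Instr.exec, Function.update_of_ne, hw2, ha]
        · simp (disch := omega) only [Instr.exec, Function.update_of_ne, hw2, hee]
        · simp (disch := omega) only [Instr.exec, Function.update_of_ne, Function.update_self, hw2,
            hw, h6, Nat.add_zero, hpn]
        · simp (disch := omega) only [Instr.exec, Function.update_of_ne, Function.update_self, hw2,
            hw, h6, hc2, hx2, hx, add_zero]
        -- Before the first round the weight is 0, so the arbitrary first candidate `p` satisfies
        -- the inequality.
        · have : min (p + 0 * b ^ i) n = p := by omega
          rw [this]
          simp
        · intro r hr2 hr4 hr5 hr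
          simp (disch := omega) only [Instr.exec, Function.update_of_ne, hw2, hw]
        · intro r hr
          simp (disch := omega) only [Instr.exec, Function.update_of_ne, hx2]
    · rw [hC, show 100 * (i + 1 + 1) * b ^ (i + 1 + 1) =
        b * (100 * (i + 1) * b ^ (i + 1)) + 100 * (b * b ^ (i + 1)) by ring]
      have := Nat.le_mul_of_pos_left (b ^ (i + 1)) hb
      have h3 := Nat.mul_le_mul_left b hbi'
      rw [show b * (100 * (i + 1) * b ^ (i + 1) + 20 + 6 * b ^ (i + 1) + 1) =
        b * (100 * (i + 1) * b ^ (i + 1)) + 21 * (b * 1) + 6 * (b * b ^ (i + 1)) by ring]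
      omega

/-! ### The complete algorithm and its running time -/

/-- `w (10 + 4 * j) := (w 3) ^ j` for all `j ≤ i`. -/
def powProg : ℕ → Prog
  | 0 => .instr (.const 10 1)
  | i + 1 =>
    .seq (powProg i) <|
    .seq (.instr (.const (14 + 4 * i) 0)) <|
    .seq (.instr (.const 5 0)) <|
    .loop (.lt 5 3) <|
      .seq (.instr (.add (14 + 4 * i) (14 + 4 * i) (10 + 4 * i))) <|
      .instr (.add 5 5 1)

lemma powProg_exec {b : ℕ} (h1 : s.w 1 = 1) (h3 : s.w 3 = b) (i : ℕ) :
    Exec O (powProg i) ((i + 1) * (4 * b + 6)) s fun s' =>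
      (∀ j ≤ i, s'.w (10 + 4 * j) = b ^ j) ∧ (∀ r < 10, r ≠ 5 → s'.w r = s.w r) ∧
      s'.x = s.x := by
  induction i with
  | zero =>
    refine (Exec.instr ⟨fun j hj => ?_, fun r hr _ => ?_, ?_⟩).mono (by omega) fun _ h => h
    · obtain rfl : j = 0 := by omega
      simp [Instr.exec]
    · simp (disch := omega) only [Instr.exec, Function.update_of_ne]
    · rfl
  | succ i ih =>
    refine (Exec.seq <| ih.mono le_rfl ?_).mono (T := (i + 1) * (4 * b + 6) + (4 * b + 5) + 1)
      (le_of_eq (by ring)) fun _ h => h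
    rintro s1 ⟨hG, hw, hx⟩
    refine (Exec.instr_seq <| Exec.instr_seq <| Exec.loop (C := 3) (fun m s' => ∃ k, k + m = b ∧
      s'.w 5 = k ∧ s'.w (14 + 4 * i) = k * b ^ i ∧ (∀ j ≤ i, s'.w (10 + 4 * j) = b ^ j) ∧
      (∀ r < 10, r ≠ 5 → s'.w r = s.w r) ∧ s'.x = s.x) ?_ ?_ b ?_).mono (by omega) fun _ h => h
    · rintro m s' ⟨k, hk, h5, hk', hG, hw, hx⟩ hc
      simp (disch := omega) only [Cond.Holds, h5, hw, h3] at hc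
      refine Exec.instr_seq <| Exec.instr ⟨m - 1, by omega, k + 1, by omega, ?_, ?_, ?_, ?_, ?_⟩
      · simp (disch := omega) only [Instr.exec, Function.update_of_ne, Function.update_self, h5,
          hw, h1]
      · simp (disch := omega) only [Instr.exec, Function.update_of_ne, Function.update_self, hk',
          hG, add_one_mul]
      · intro j hj
        simp (disch := omega) only [Instr.exec, Function.update_of_ne, hG]
      · intro r hr hr5
        simp (disch := omega) only [Instr.exec, Function.update_of_ne, hw]
      · simpa [Instr.exec] using hx
    · rintro m s' ⟨k, hk, h5, hk', hG, hw, hx⟩ hc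
      simp (disch := omega) only [Cond.Holds, h5, hw, h3] at hc
      obtain rfl : k = b := by omega
      refine ⟨fun j hj => ?_, hw, hx⟩
      obtain hj | rfl := Nat.lt_or_eq_of_le hj
      · exact hG j (by omega)
      · rw [pow_succ', ← hk', show 10 + 4 * (i + 1) = 14 + 4 * i by ring]
    · refine ⟨0, by omega, ?_, ?_, ?_, ?_, ?_⟩
      · simp [Instr.exec]
      · simp (disch := omega) only [Instr.exec, Function.update_of_ne, Function.update_self,
          zero_mul]
      · intro j hj
        simp (disch := omega) only [Instr.exec, Function.update_of_ne, hG]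
      · intro r hr hr5
        simp (disch := omega) only [Instr.exec, Function.update_of_ne, hw]
      · simpa [Instr.exec] using hx

/-- The algorithm: it finds the least `b ≥ 1` with `n ≤ b ^ h` and then treats all points as one
block. -/
def medianProg (h : ℕ) : Prog :=
  .seq (.instr (.const 1 1)) <|
  .seq (.instr (.const 3 1)) <|
  .seq (powProg h) <|
  .seq (.loop (.lt (10 + 4 * h) 0) <| .seq (.instr (.add 3 3 1)) (powProg h)) <|
  .seq (blockProg h) <|
  .instr (.add 0 (13 + 4 * h) 6)

/-- The search for the base never passes `B`, since `b ^ h < n ≤ B ^ h` forces `b < B`. Recomputing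
the powers costs O(hB) in each of at most `B` rounds, which fits into `B ^ (h + 1)` because `1 ≤ h`.
-/
lemma medianProg_exec {n h B : ℕ} (hO : IsPseudoOracle O n) (hh : 1 ≤ h) (hn : 1 ≤ n) (hB : 1 ≤ B)
    (hnB : n ≤ B ^ h) (hs : s.w = Function.update (fun _ => 0) 0 n) (hx : s.x 2 = 0) :
    Exec O (medianProg h) (200 * (h + 1) * B ^ (h + 1)) s fun s' =>
      IsBlockMedian O n h 0 n (s'.w 0) := by
  refine (Exec.instr_seq <| Exec.instr_seq <| Exec.seq
    (T' := B * ((h + 1) * (4 * B + 6) + 3) + 1 + 1 + (100 * (h + 1) * B ^ (h + 1) + 2)) <|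
    (powProg_exec (b := 1) ?_ ?_ h).mono le_rfl ?_).mono ?_ fun _ h => h
  · simp [Instr.exec]
  · simp [Instr.exec]
  · rintro s1 ⟨hG, hw, hx1⟩
    refine (Exec.seq (T' := 100 * (h + 1) * B ^ (h + 1) + 2) <|
      Exec.loop (C := (h + 1) * (4 * B + 6) + 2) (fun m s' => ∃ b,
      b + m = B ∧ 1 ≤ b ∧ (∀ j ≤ h, s'.w (10 + 4 * j) = b ^ j) ∧ s'.w 0 = n ∧ s'.w 1 = 1 ∧
      s'.w 2 = 0 ∧ s'.w 3 = b ∧ s'.w 6 = 0 ∧ s'.x 2 = 0) ?_ ?_ (B - 1) ?_).mono ?_ fun _ h => h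
    · rintro m s' ⟨b, hb, hb1, hG, h0, h1, h2, h3, h6, hx2⟩ hc
      simp only [Cond.Holds, hG h le_rfl, h0] at hc
      have hbB : b < B := lt_of_pow_lt_pow_left₀ h (Nat.zero_le B) (hc.trans_le hnB)
      refine (Exec.instr_seq <| (powProg_exec (b := b + 1) ?_ ?_ h).mono
        (T' := (h + 1) * (4 * B + 6)) ?_ ?_).mono le_rfl fun _ h => h
      · simp [Instr.exec, h1]
      · simp [Instr.exec, h3, h1]
      · exact Nat.mul_le_mul_left _ (by omega)
      · rintro s2 ⟨hG', hw', hx'⟩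
        refine ⟨m - 1, by omega, b + 1, by omega, by omega, hG', ?_, ?_, ?_, ?_, ?_, ?_⟩ <;>
        simp [Instr.exec, hw', hx', h0, h1, h2, h3, h6, hx2]
    · rintro m s' ⟨b, hb, hb1, hG, h0, h1, h2, h3, h6, hx2⟩ hc
      simp only [Cond.Holds, hG h le_rfl, h0, not_lt] at hc
      refine Exec.seq <| (blockProg_exec hO hb1 h s' 0 h0 h1 h6 hG hx2 h2 hn).mono ?_ ?_
      · exact Nat.mul_le_mul_left _ (Nat.pow_le_pow_left (by omega) _)
      rintro s2 ⟨-, hm, hw, -⟩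
      refine Exec.instr ?_
      have : min (0 + b ^ h) n = n := by omega
      rw [this] at hm
      have h6' : s2.w 6 = 0 := by rw [hw _ (by omega) (by omega) (by omega) (by omega), h6]
      simpa [Instr.exec, h6'] using hm
    · refine ⟨1, by omega, le_rfl, hG, ?_, ?_, ?_, ?_, ?_, ?_⟩ <;>
      simp [Instr.exec, hw, hx1, hx, hs]
    · have : (B - 1) * ((h + 1) * (4 * B + 6) + 2 + 1) ≤ B * ((h + 1) * (4 * B + 6) + 3) :=
        Nat.mul_le_mul_right _ (Nat.sub_le B 1)
      omega
  · have h1 : B * B ≤ B ^ (h + 1) := by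
      rw [← pow_two]
      exact Nat.pow_le_pow_right hB (by omega)
    have h2 : B ≤ B * B := Nat.le_mul_of_pos_left B hB
    have h3 := Nat.mul_le_mul_left (h + 1) h1
    have h4 := Nat.mul_le_mul_left (h + 1) h2
    nlinarith

lemma IsMetric.isPseudoOracle {n : ℕ} {d : Fin n → Fin n → ℝ} (hd : IsMetric d) :
    IsPseudoOracle (oracle d) n where
  nonneg x hx y hy := by simpa [oracle, hx, hy] using hd.nonneg _ _
  self x hx := by simpa [oracle, hx] using hd.self _
  symm x hx y hy := by simpa [oracle, hx, hy] using hd.symm _ _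
  triangle x hx y hy z hz := by simpa [oracle, hx, hy, hz] using hd.triangle _ _ _

lemma IsBlockMedian.isApproxOutput {n h m : ℕ} {d : Fin n → Fin n → ℝ}
    (H : IsBlockMedian (oracle d) n h 0 n m) : IsApproxOutput (2 * h) d m := by
  refine ⟨⟨m, H.1⟩, rfl, fun y => ?_⟩
  have h1 := H.2 y y.2
  simp only [Nat.Ico_zero_eq_range, Finset.sum_range] at h1
  simpa [oracle, H.1] using h1

/-- The metric 1-median has a deterministic `O(n ^ (1 + 1 / h))`-time `2 h`-approximation. -/
theorem hasTimeAlgorithm {h : ℕ} (hh : 1 ≤ h) {ε : ℝ} (hε : 1 / (h : ℝ) ≤ ε) :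
    HasTimeAlgorithm (1 + ε) (2 * h) := by
  have hh0 : (0 : ℝ) < h := by exact_mod_cast hh
  -- `B` occurs only in the analysis. The added 1 ensures `n ≤ B n ^ h`, and `B n` is still at most
  -- twice the h-th root of `n`.
  let B : ℕ → ℕ := fun n => ⌊(n : ℝ) ^ (1 / (h : ℝ))⌋₊ + 1
  have key : ∀ n : ℕ, 1 ≤ n → ∀ d : Fin n → Fin n → ℝ, IsMetric d →
      ∃ t ≤ 200 * (h + 1) * B n ^ (h + 1), HaltedBy (medianProg h) n (oracle d) t ∧
        IsApproxOutput (2 * h) d ((after (medianProg h) n (oracle d) t).store.w 0) := by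
    intro n hn d hd
    have hnB : n ≤ B n ^ h := by
      have h1 : (n : ℝ) ^ (1 / (h : ℝ)) ≤ B n := by
        simpa [B] using (Nat.lt_floor_add_one ((n : ℝ) ^ (1 / (h : ℝ)))).le
      have h2 := pow_le_pow_left₀ (by positivity) h1 h
      rw [← Real.rpow_natCast, ← Real.rpow_mul (by positivity), one_div_mul_cancel hh0.ne',
        Real.rpow_one] at h2
      exact_mod_cast h2
    obtain ⟨t, ht, s', hs', hm⟩ := medianProg_exec (B := B n)
      (s := (init (medianProg h) n).store) hd.isPseudoOracle hh hn (by simp [B]) hnB rfl rfl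
    have : after (medianProg h) n (oracle d) t = ⟨[], s'⟩ := hs' []
    refine ⟨t, ht, ?_, ?_⟩
    · rw [HaltedBy, this]
    · rw [this]
      exact hm.isApproxOutput
  refine ⟨medianProg h, fun n => 200 * (h + 1) * B n ^ (h + 1), fun n hn d hd => ?_,
    fun n hn d hd => ?_, ?_⟩
  · obtain ⟨t, -, h1⟩ := key n hn d hd
    exact ⟨t, h1⟩
  · obtain ⟨t, ht, h1, -⟩ := key n hn d hd
    obtain ⟨u, hu⟩ := Nat.exists_eq_add_of_le' ht
    rw [HaltedBy, after] at h1 ⊢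
    obtain ⟨s, hs⟩ : ∃ s, (step (oracle d))^[t] (init (medianProg h) n) = ⟨[], s⟩ :=
      ⟨_, by rw [← h1]⟩
    beta_reduce
    rw [hu, Function.iterate_add_apply, hs, step_iterate_nil]
  · refine IsBigO.of_bound (200 * (h + 1) * 2 ^ (h + 1)) ?_
    filter_upwards [eventually_ge_atTop 1] with n hn
    have hn' : (1 : ℝ) ≤ n := by exact_mod_cast hn
    have h1 : (B n : ℝ) ≤ 2 * (n : ℝ) ^ (1 / (h : ℝ)) := by
      have h1 := Nat.floor_le (by positivity : 0 ≤ (n : ℝ) ^ (1 / (h : ℝ)))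
      have h2 := Real.one_le_rpow hn' (by positivity : 0 ≤ 1 / (h : ℝ))
      simp only [B]
      push_cast
      linarith
    have h2 : ((n : ℝ) ^ (1 / (h : ℝ))) ^ (h + 1) ≤ (n : ℝ) ^ (1 + ε) := by
      rw [← Real.rpow_natCast, ← Real.rpow_mul (by positivity)]
      refine Real.rpow_le_rpow_of_exponent_le hn' ?_
      push_cast
      rw [mul_add, one_div_mul_cancel hh0.ne']
      linarith
    rw [Real.norm_of_nonneg (by positivity), Real.norm_of_nonneg (by positivity)]
    push_cast
    rw [mul_assoc (200 * ((h : ℝ) + 1))]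
    refine mul_le_mul_of_nonneg_left ?_ (by positivity)
    calc (B n : ℝ) ^ (h + 1) ≤ (2 * (n : ℝ) ^ (1 / (h : ℝ))) ^ (h + 1) :=
          pow_le_pow_left₀ (by positivity) h1 _
      _ ≤ _ := by
          rw [mul_pow]
          exact mul_le_mul_of_nonneg_left h2 (by positivity)

end

/-! ### From programs to query strategies -/

/-- The next instruction is a query. -/
def Config.AtQuery (c : Config) : Prop :=
  ∃ r a b k s, c = ⟨.instr (.query r a b) :: k, s⟩

lemma step_eq_of_not_atQuery {c : Config} (hc : ¬ c.AtQuery) (O O' : ℕ → ℕ → ℝ) :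
    step O c = step O' c := by
  rcases c with ⟨_ | ⟨_ | i | _ | _ | _, k⟩, s⟩ <;> try rfl
  cases i <;> first | rfl | exact absurd ⟨_, _, _, _, _, rfl⟩ hc

lemma queries_step_of_not_atQuery {c : Config} (hc : ¬ c.AtQuery) (O : ℕ → ℕ → ℝ) :
    (step O c).store.queries = c.store.queries := by
  rcases c with ⟨_ | ⟨_ | i | _ | _ | _, k⟩, s⟩ <;> try rfl
  · cases i <;> first | rfl | exact absurd ⟨_, _, _, _, _, rfl⟩ hc
  · simp only [step]
    split_ifs <;> rfl
  · simp only [step]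
    split_ifs <;> rfl

lemma queries_step (c : Config) (O : ℕ → ℕ → ℝ) :
    c.store.queries ≤ (step O c).store.queries ∧
      (step O c).store.queries ≤ c.store.queries + 1 := by
  by_cases hc : c.AtQuery
  · obtain ⟨r, a, b, k, s, rfl⟩ := hc
    simp [step, Instr.exec]
  · simp [queries_step_of_not_atQuery hc]

lemma queries_iterate (c : Config) (O : ℕ → ℕ → ℝ) (t : ℕ) :
    c.store.queries ≤ ((step O)^[t] c).store.queries ∧
      ((step O)^[t] c).store.queries ≤ c.store.queries + t := by
  induction t with
  | zero => simp
  | succ t ih =>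
    rw [Function.iterate_succ_apply']
    have := queries_step ((step O)^[t] c) O
    omega

lemma iterate_of_todo_eq_nil {c : Config} (hc : c.todo = []) (O : ℕ → ℕ → ℝ) (t : ℕ) :
    (step O)^[t] c = c := by
  obtain ⟨_, s⟩ := c
  obtain rfl : _ = [] := hc
  exact step_iterate_nil t

lemma iterate_of_halted {c : Config} {O : ℕ → ℕ → ℝ} {t u : ℕ} (ht : ((step O)^[t] c).todo = [])
    (htu : t ≤ u) : (step O)^[u] c = (step O)^[t] c := by
  obtain ⟨v, rfl⟩ := Nat.exists_eq_add_of_le' htu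
  rw [Function.iterate_add_apply, iterate_of_todo_eq_nil ht]

lemma iterate_eq_of_not_atQuery {c : Config} (O O' : ℕ → ℕ → ℝ) (t : ℕ)
    (h : ∀ u < t, ¬ ((step O)^[u] c).AtQuery) :
    (step O')^[t] c = (step O)^[t] c ∧ ((step O)^[t] c).store.queries = c.store.queries := by
  induction t with
  | zero => simp
  | succ t ih =>
    obtain ⟨h1, h2⟩ := ih fun u hu => h u (by omega)
    rw [Function.iterate_succ_apply', Function.iterate_succ_apply', h1]
    exact ⟨step_eq_of_not_atQuery (h t (by omega)) _ _,
      (queries_step_of_not_atQuery (h t (by omega)) _).trans h2⟩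

/-- Between queries a run does not depend on the oracle, so the zero oracle leads to the next query;
the tree asks it and recurses on the budget `m`. The budget is needed because on answers that come
from no metric the program may query forever. Where it does not halt within the budget, the output
is arbitrary. -/
lemma exists_tree (m : ℕ) : ∀ c : Config, ∃ T : QueryTree, (∀ O, T.queries O ≤ m) ∧
    ∀ O t, ((step O)^[t] c).todo = [] →
      ((step O)^[t] c).store.queries ≤ c.store.queries + m →
      T.run O = ((step O)^[t] c).store.w 0 := by
  classical
  induction m with
  | zero =>
    intro c
    by_cases hh : ∃ O t, ((step O)^[t] c).todo = [] ∧
      ((step O)^[t] c).store.queries ≤ c.store.queries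
    · obtain ⟨O, t, ht, hq⟩ := hh
      refine ⟨.output (((step O)^[t] c).store.w 0), fun _ => le_rfl, fun O' t' ht' hq' => ?_⟩
      have key : ∀ u, ¬ ((step O)^[u] c).AtQuery := by
        rintro u ⟨r, a, b, k, s, hu⟩
        have h1 : u < t := by
          by_contra hut
          rw [iterate_of_halted ht (not_lt.1 hut)] at hu
          simp [hu] at ht
        have h2 := (queries_iterate c O u).1
        obtain ⟨v, rfl⟩ := Nat.exists_eq_add_of_le' h1
        rw [Function.iterate_add_apply, Function.iterate_succ_apply'] at hq
        have h3 := (queries_iterate (step O ((step O)^[u] c)) O v).1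
        rw [hu] at hq h3 h2
        simp only [step, Instr.exec] at h2 h3 hq
        omega
      have h1 := (iterate_eq_of_not_atQuery O O' t fun u _ => key u).1
      rw [← h1] at ht ⊢
      rcases le_total t t' with h | h
      · rw [iterate_of_halted ht h]; rfl
      · rw [← iterate_of_halted ht' h]; rfl
    · push Not at hh
      refine ⟨.output 0, fun _ => le_rfl, fun O t ht hq => ?_⟩
      exact absurd hq (not_le.2 (hh O t ht))
  | succ m ih =>
    intro c
    by_cases H : ∃ u, ((step fun _ _ => 0)^[u] c).AtQuery
    · obtain ⟨r, a, b, k, s, hu⟩ := Nat.find_spec H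
      set u := Nat.find H
      have hmin : ∀ v < u, ¬ ((step fun _ _ => 0)^[v] c).AtQuery := fun v hv => Nat.find_min H hv
      choose T hT1 hT2 using fun y : ℝ =>
        ih ⟨k, { s with x := Function.update s.x r y, queries := s.queries + 1 }⟩
      refine ⟨.query (s.w a) (s.w b) T, fun O => Nat.succ_le_succ (hT1 _ O), fun O t ht hq => ?_⟩
      obtain ⟨h1, h2⟩ := iterate_eq_of_not_atQuery (fun _ _ => 0) O u hmin
      rw [hu] at h1 h2
      have hut : u < t := by
        by_contra hut
        rw [iterate_of_halted ht (not_lt.1 hut)] at h1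
        simp [h1] at ht
      obtain ⟨v, rfl⟩ := Nat.exists_eq_add_of_le' hut
      rw [Function.iterate_add_apply, Function.iterate_succ_apply', h1] at ht hq ⊢
      refine hT2 (O (s.w a) (s.w b)) O v ht (hq.trans ?_)
      simp only at h2 ⊢
      omega
    · push Not at H
      by_cases hh : ∃ t, ((step fun _ _ => 0)^[t] c).todo = []
      · obtain ⟨t, ht⟩ := hh
        refine ⟨.output (((step fun _ _ => 0)^[t] c).store.w 0), fun _ => Nat.zero_le _,
          fun O t' ht' hq' => ?_⟩
        rw [(iterate_eq_of_not_atQuery (fun _ _ => 0) O t' fun u _ => H u).1] at ht' ⊢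
        rcases le_total t t' with h | h
        · rw [iterate_of_halted ht h]; rfl
        · rw [← iterate_of_halted ht' h]; rfl
      · push Not at hh
        refine ⟨.output 0, fun _ => Nat.zero_le _, fun O t ht hq => ?_⟩
        rw [(iterate_eq_of_not_atQuery (fun _ _ => 0) O t fun u _ => H u).1] at ht
        exact absurd ht (hh t)

lemma HasQueryAlgorithm.hasQueryStrategy {e c : ℝ} (H : HasQueryAlgorithm e c) :
    HasQueryStrategy e c := by
  obtain ⟨A, q, hA, hq, hO⟩ := H
  choose T hT1 hT2 using fun n => exists_tree (q n) (init A n)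
  refine ⟨T, q, fun n hn d hd => ?_, fun n hn d hd => hT1 n _, hO⟩
  obtain ⟨t, ht, h⟩ := hA n hn d hd
  rw [hT2 n (oracle d) t ht ((hq n hn d hd t).trans (Nat.le_add_left _ _))]
  exact h

lemma HasTimeAlgorithm.hasQueryAlgorithm {e c : ℝ} (H : HasTimeAlgorithm e c) :
    HasQueryAlgorithm e c := by
  obtain ⟨A, T, hA, hT, hO⟩ := H
  refine ⟨A, T, hA, fun n hn d hd t => ?_, hO⟩
  have h1 : ((step (oracle d))^[T n] (init A n)).todo = [] := hT n hn d hd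
  have h2 := (queries_iterate (init A n) (oracle d) (min t (T n))).2
  have h3 : (step (oracle d))^[t] (init A n) = (step (oracle d))^[min t (T n)] (init A n) := by
    rcases le_total t (T n) with h | h
    · rw [min_eq_left h]
    · rw [min_eq_right h, iterate_of_halted h1 h]
  rw [after, h3]
  have h4 : (init A n).store.queries = 0 := rfl
  omega

/-! ### Hop distances in a finite graph -/

/-- The least `k` with `P k`, or `h` if this is smaller. -/
def capInf (h : ℕ) (P : ℕ → Prop) : ℕ := sInf {k | h ≤ k ∨ P k}

lemma capInf_le_iff {h k : ℕ} {P : ℕ → Prop} (hP : ∀ k, P k → P (k + 1)) :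
    capInf h P ≤ k ↔ h ≤ k ∨ P k := by
  refine ⟨fun hk => ?_, fun hk => Nat.sInf_le hk⟩
  have hmem : h ≤ capInf h P ∨ P (capInf h P) :=
    Nat.sInf_mem (s := {k | h ≤ k ∨ P k}) ⟨h, Or.inl le_rfl⟩
  exact hmem.imp (fun H => H.trans hk) fun H => Nat.le_induction H (fun k _ => hP k) k hk

lemma capInf_le (h : ℕ) (P : ℕ → Prop) : capInf h P ≤ h := Nat.sInf_le (Or.inl le_rfl)

variable {V : Type*}

/-- There is a path with at most `k` edges from `a` to `b`. -/
def Within (E : Finset (V × V)) : ℕ → V → V → Prop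
  | 0, a, b => a = b
  | k + 1, a, b => Within E k a b ∨ ∃ c, Within E k a c ∧ (c, b) ∈ E

section
variable {E E' : Finset (V × V)} {a b c u v : V} {k l : ℕ}

lemma Within.succ (H : Within E k a b) : Within E (k + 1) a b := Or.inl H

lemma Within.mono (H : Within E k a b) (hkl : k ≤ l) : Within E l a b :=
  Nat.le_induction H (fun _ _ h => h.succ) l hkl

lemma Within.mono_left (hE : E ⊆ E') : ∀ {k : ℕ} {b : V}, Within E k a b → Within E' k a b
  | 0, _, H => H
  | _ + 1, _, H => H.imp (Within.mono_left hE) fun ⟨c, h, hc⟩ => ⟨c, h.mono_left hE, hE hc⟩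

lemma within_refl (E : Finset (V × V)) (k : ℕ) (a : V) : Within E k a a :=
  Within.mono (k := 0) rfl (Nat.zero_le k)

lemma within_of_mem (H : (a, b) ∈ E) : Within E 1 a b := Or.inr ⟨a, rfl, H⟩

lemma Within.trans (H : Within E k a b) : ∀ {l : ℕ} {c : V}, Within E l b c → Within E (k + l) a c
  | 0, _, H' => by obtain rfl : b = _ := H'; exact H
  | _ + 1, _, H' => H'.imp (Within.trans H) fun ⟨c, h, hc⟩ => ⟨c, H.trans h, hc⟩

lemma Within.symm (hE : ∀ a b, (a, b) ∈ E → (b, a) ∈ E) :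
    ∀ {k : ℕ} {b : V}, Within E k a b → Within E k b a
  | 0, _, H => Eq.symm H
  | k + 1, _, H => by
    rcases H with H | ⟨c, h, hc⟩
    · exact (H.symm hE).succ
    · exact ((within_of_mem (hE _ _ hc)).trans (h.symm hE)).mono (by omega)

variable [DecidableEq V]

/-- A path that uses new edges between `u` and `v` starts and ends with old paths between its ends
and the points `u` and `v`. -/
lemma Within.of_insert : ∀ {k : ℕ} {b : V}, Within (insert (u, v) (insert (v, u) E)) k a b →
    Within E k a b ∨ ∃ i j p q, i + 1 + j ≤ k ∧ (p = u ∨ p = v) ∧ (q = u ∨ q = v) ∧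
      Within E i a p ∧ Within E j q b
  | 0, _, H => Or.inl H
  | k + 1, b, H => by
    rcases H with H | ⟨c, H, hc⟩
    · rcases H.of_insert with H | ⟨i, j, p, q, hij, hp, hq, h1, h2⟩
      · exact Or.inl H.succ
      · exact Or.inr ⟨i, j, p, q, by omega, hp, hq, h1, h2⟩
    · rw [Finset.mem_insert, Finset.mem_insert, Prod.mk.injEq, Prod.mk.injEq] at hc
      rcases H.of_insert with H' | ⟨i, j, p, q, hij, hp, hq, h1, h2⟩
      · rcases hc with ⟨rfl, rfl⟩ | ⟨rfl, rfl⟩ | hc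
        · exact Or.inr ⟨k, 0, _, _, by omega, Or.inl rfl, Or.inr rfl, H', rfl⟩
        · exact Or.inr ⟨k, 0, _, _, by omega, Or.inr rfl, Or.inl rfl, H', rfl⟩
        · exact Or.inl (Or.inr ⟨c, H', hc⟩)
      · rcases hc with ⟨rfl, rfl⟩ | ⟨rfl, rfl⟩ | hc
        · exact Or.inr ⟨i, 0, p, _, by omega, hp, Or.inr rfl, h1, rfl⟩
        · exact Or.inr ⟨i, 0, p, _, by omega, hp, Or.inl rfl, h1, rfl⟩
        · exact Or.inr ⟨i, j + 1, p, q, by omega, hp, hq, h1, Or.inr ⟨c, h2, hc⟩⟩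

/-! ### Degrees and sizes of balls -/

/-- The number of neighbours of `u`. -/
def deg (E : Finset (V × V)) (u : V) : ℕ := (E.filter fun p => p.1 = u).card

lemma deg_insert_le (p : V × V) (w : V) :
    deg (insert p E) w ≤ deg E w + if p.1 = w then 1 else 0 := by
  rw [deg, deg, Finset.filter_insert]
  split_ifs with h
  · exact Finset.card_insert_le _ _
  · exact le_rfl

lemma deg_mono (hE : E ⊆ E') (w : V) : deg E w ≤ deg E' w :=
  Finset.card_le_card (Finset.filter_subset_filter _ hE)

variable [Fintype V]

lemma card_neighbors_le (E : Finset (V × V)) (u : V) :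
    (Finset.univ.filter fun v => (u, v) ∈ E).card ≤ deg E u := by
  refine Finset.card_le_card_of_injOn (fun v => (u, v)) (fun v hv => ?_) fun v _ w _ h => ?_
  · simpa using hv
  · exact (Prod.mk.inj h).2

/-- Double counting; it limits how many points have used up their budget `D` of edges or of recorded
pairs. -/
lemma card_mul_le_of_le_deg {D : ℕ} {S : Finset V} (hS : ∀ u ∈ S, D ≤ deg E u) :
    S.card * D ≤ E.card := by
  rw [Finset.card_eq_sum_card_fiberwise (f := Prod.fst) (t := Finset.univ) fun _ _ => by simp,
    ← smul_eq_mul]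
  exact (Finset.card_nsmul_le_sum S _ D hS).trans
    (Finset.sum_le_sum_of_subset (Finset.subset_univ S))

-- Staying or following one of at most `D` edges enlarges a ball by a factor of at most `D + 1`.
open Classical in
lemma card_ball_le {D : ℕ} (hD : ∀ u, deg E u ≤ D) (a : V) (k : ℕ) :
    (Finset.univ.filter fun b => Within E k a b).card ≤ (D + 1) ^ k := by
  induction k with
  | zero =>
    refine Finset.card_le_one.2 fun b hb c hc => ?_
    exact Eq.trans (Eq.symm (Finset.mem_filter.1 hb).2) (Finset.mem_filter.1 hc).2
  | succ k ih =>
    have hsub : (Finset.univ.filter fun b => Within E (k + 1) a b) ⊆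
        (Finset.univ.filter fun b => Within E k a b) ∪
        (Finset.univ.filter fun b => Within E k a b).biUnion
          fun c => Finset.univ.filter fun b => (c, b) ∈ E := by
      intro b hb
      rcases (Finset.mem_filter.1 hb).2 with H | ⟨c, H, hc⟩
      · exact Finset.mem_union_left _ (by simpa using H)
      · refine Finset.mem_union_right _ (Finset.mem_biUnion.2 ⟨c, ?_, ?_⟩)
        · simpa using H
        · simpa using hc
    refine (Finset.card_le_card hsub).trans ((Finset.card_union_le _ _).trans ?_)
    have h1 := Finset.card_biUnion_le_card_mul (Finset.univ.filter fun b => Within E k a b)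
      (fun c => Finset.univ.filter fun b => (c, b) ∈ E) D
      fun c _ => (card_neighbors_le E c).trans (hD c)
    calc _ ≤ _ + _ := Nat.add_le_add_left h1 _
      _ = (Finset.univ.filter fun b => Within E k a b).card * (D + 1) := by ring
      _ ≤ _ := Nat.mul_le_mul_right _ ih

end

/-- The hop distance, or `h` if this is smaller. -/
def hop (h : ℕ) (E : Finset (V × V)) (a b : V) : ℕ := capInf h fun k => Within E k a b

/-- The hop distance to the set `N`, or `h` if this is smaller. -/
def hopTo (h : ℕ) (E : Finset (V × V)) (N : Finset V) (a : V) : ℕ :=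
  capInf h fun k => ∃ u ∈ N, Within E k a u

section
variable {E E' : Finset (V × V)} {N N' : Finset V} {h g k : ℕ} {a b c u v : V}

lemma hop_le_iff : hop h E a b ≤ k ↔ h ≤ k ∨ Within E k a b := capInf_le_iff fun _ H => H.succ

lemma hopTo_le_iff : hopTo h E N a ≤ k ↔ h ≤ k ∨ ∃ u ∈ N, Within E k a u :=
  capInf_le_iff fun _ ⟨u, hu, H⟩ => ⟨u, hu, H.succ⟩

lemma hop_le : hop h E a b ≤ h := capInf_le _ _

lemma hopTo_le : hopTo h E N a ≤ h := capInf_le _ _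

lemma hop_symm (hE : ∀ a b, (a, b) ∈ E → (b, a) ∈ E) (a b : V) : hop h E a b = hop h E b a := by
  refine le_antisymm ?_ ?_ <;> rw [hop_le_iff]
  · exact (hop_le_iff.1 le_rfl).imp_right fun H => H.symm hE
  · exact (hop_le_iff.1 le_rfl).imp_right fun H => H.symm hE

lemma hop_triangle (a b c : V) : hop h E a c ≤ hop h E a b + hop h E b c := by
  rw [hop_le_iff]
  rcases hop_le_iff.1 (le_refl (hop h E a b)) with H | H
  · omega
  rcases hop_le_iff.1 (le_refl (hop h E b c)) with H' | H'
  · omega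
  exact Or.inr (H.trans H')

lemma hopTo_triangle (hgh : g ≤ h) (a b : V) : hopTo g E N a ≤ hop h E a b + hopTo g E N b := by
  rw [hopTo_le_iff]
  rcases hop_le_iff.1 (le_refl (hop h E a b)) with H | H
  · omega
  rcases hopTo_le_iff.1 (le_refl (hopTo g E N b)) with H' | ⟨u, hu, H'⟩
  · omega
  exact Or.inr ⟨u, hu, H.trans H'⟩

lemma hop_pos (hh : 1 ≤ h) (hab : a ≠ b) : 1 ≤ hop h E a b := by
  by_contra! H
  rcases hop_le_iff.1 (Nat.lt_one_iff.1 H).le with H | H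
  · omega
  · exact hab H

lemma hopTo_of_mem (hu : u ∈ N) : hopTo h E N u = 0 :=
  Nat.le_zero.1 (hopTo_le_iff.2 (Or.inr ⟨u, hu, rfl⟩))

lemma hopTo_anti (hN : N' ⊆ N) (a : V) : hopTo h E N a ≤ hopTo h E N' a :=
  hopTo_le_iff.2 ((hopTo_le_iff.1 le_rfl).imp_right fun ⟨u, hu, H⟩ => ⟨u, hN hu, H⟩)

variable [DecidableEq V]

/-- New edges between points of `N` do not change the distance to `N`. -/
lemma hopTo_le_insert (hu : u ∈ N) (hv : v ∈ N) (hN : N' ⊆ N) (a : V) :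
    hopTo h E N a ≤ hopTo h (insert (u, v) (insert (v, u) E)) N' a := by
  rw [hopTo_le_iff]
  refine (hopTo_le_iff.1 le_rfl).imp_right ?_
  rintro ⟨w, hw, H⟩
  -- The first new edge on the path starts in `N`, so the old piece before it already reaches `N`.
  rcases H.of_insert with H | ⟨i, j, p, q, hij, hp, hq, h1, h2⟩
  · exact ⟨w, hN hw, H⟩
  · refine ⟨p, ?_, h1.mono (by omega)⟩
    rcases hp with rfl | rfl <;> assumption

/-- New edges between points of `N` do not change distances for which it would not pay to jump from
one point of `N` to another one. -/
lemma hop_insert (hE : ∀ a b, (a, b) ∈ E → (b, a) ∈ E) (hu : u ∈ N) (hv : v ∈ N)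
    (hab : hop h E a b ≤ 1 + hopTo g E N a + hopTo g E N b) :
    hop h (insert (u, v) (insert (v, u) E)) a b = hop h E a b := by
  refine le_antisymm ?_ ?_
  · rw [hop_le_iff]
    exact (hop_le_iff.1 le_rfl).imp_right fun H =>
      H.mono_left ((Finset.subset_insert _ _).trans (Finset.subset_insert _ _))
  · rcases hop_le_iff.1 (le_refl (hop h (insert (u, v) (insert (v, u) E)) a b)) with H | H
    · exact hop_le.trans H
    rcases H.of_insert with H | ⟨i, j, p, q, hij, hp, hq, h1, h2⟩
    · exact hop_le_iff.2 (Or.inr H)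
    · have hp' : p ∈ N := by rcases hp with rfl | rfl <;> assumption
      have hq' : q ∈ N := by rcases hq with rfl | rfl <;> assumption
      -- A path with new edges has length at least `i + 1 + j`, which by these bounds is no shorter
      -- than the old distance.
      have h3 : hopTo g E N a ≤ i := hopTo_le_iff.2 (Or.inr ⟨p, hp', h1⟩)
      have h4 : hopTo g E N b ≤ j := hopTo_le_iff.2 (Or.inr ⟨q, hq', h2.symm hE⟩)
      omega

end

/-! ### The adversary -/

/-- What the adversary has fixed: the edges `E` of a graph, in both directions, in which
neighbours have distance `2`, and pairs `K` of a point of the reserve and another point that have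
distance `2 g + 1`. -/
structure Adversary (V : Type*) where
  E : Finset (V × V)
  K : Finset (V × V)

namespace Adversary

variable {V : Type*} [DecidableEq V] {g D m : ℕ} {Y : Finset V} {σ : Adversary V}

/-- The invariants after `m` queries. -/
structure Valid (D m : ℕ) (σ : Adversary V) : Prop where
  symm : ∀ a b, (a, b) ∈ σ.E → (b, a) ∈ σ.E
  degE : ∀ u, deg σ.E u ≤ D
  degK : ∀ u, deg σ.K u ≤ D
  cardE : σ.E.card ≤ 2 * m
  cardK : σ.K.card ≤ m

lemma Valid.mono {l : ℕ} (H : Valid D m σ) (hml : m ≤ l) : Valid D l σ :=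
  ⟨H.symm, H.degE, H.degK, H.cardE.trans (by omega), H.cardK.trans hml⟩

/-- Add an edge. -/
def addEdge (σ : Adversary V) (u v : V) : Adversary V :=
  ⟨insert (u, v) (insert (v, u) σ.E), σ.K⟩

/-- Fix the distance of a point of the reserve from another point. -/
def addPair (σ : Adversary V) (y x : V) : Adversary V := ⟨σ.E, insert (y, x) σ.K⟩

/-- The distance `r` of the point `y` of the reserve from the point `x` is fixed. -/
def FarSettled (g D : ℕ) (σ : Adversary V) (y x : V) (r : ℕ) : Prop :=
  ((y, x) ∈ σ.K ∧ r = 2 * g + 1) ∨ ((y, x) ∉ σ.K ∧ D ≤ deg σ.K y ∧ r = 2 * g + 2)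

lemma Valid.addPair {y x : V} (H : Valid D m σ) (hy : deg σ.K y < D) :
    Valid D (m + 1) (σ.addPair y x) where
  symm := H.symm
  degE := H.degE
  degK w := by
    have h1 := deg_insert_le (E := σ.K) (y, x) w
    have h5 := H.degK w
    change deg (insert (y, x) σ.K) w ≤ D
    simp only at h1
    split_ifs at h1 with hw
    · subst hw
      omega
    · omega
  cardE := H.cardE.trans (by omega)
  cardK := (Finset.card_insert_le _ _).trans (Nat.succ_le_succ H.cardK)

/-- A pair settled without a record belongs to a point whose budget is used up, and such a point
gets no further record. -/
lemma FarSettled.addPair {y x a b : V} {r : ℕ} (hy : deg σ.K y < D)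
    (H : FarSettled g D σ a b r) : FarSettled g D (σ.addPair y x) a b r := by
  rcases H with ⟨h1, h2⟩ | ⟨h1, h2, h3⟩
  · exact Or.inl ⟨Finset.mem_insert_of_mem h1, h2⟩
  · refine Or.inr ⟨fun h => ?_, h2.trans (deg_mono (Finset.subset_insert _ _) a), h3⟩
    rcases Finset.mem_insert.1 h with h | h
    · obtain ⟨rfl, rfl⟩ := Prod.mk.inj h
      omega
    · exact h1 h

variable [Fintype V]

/-- The points outside of the reserve `Y` that can get more edges. -/
def free (D : ℕ) (Y : Finset V) (σ : Adversary V) : Finset V :=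
  Finset.univ.filter fun u => u ∉ Y ∧ deg σ.E u < D

lemma mem_free {u : V} : u ∈ free D Y σ ↔ u ∉ Y ∧ deg σ.E u < D := by simp [free]

/-- The distance `r` of two points outside of the reserve is fixed. -/
def NearSettled (g D : ℕ) (Y : Finset V) (σ : Adversary V) (a b : V) (r : ℕ) : Prop :=
  r = 2 * hop (g + 1) σ.E a b ∧
    hop (g + 1) σ.E a b ≤ 1 + hopTo g σ.E (free D Y σ) a + hopTo g σ.E (free D Y σ) b

/-- The distance `r` of `a` and `b` is fixed. -/
structure Settled (g D : ℕ) (Y : Finset V) (σ : Adversary V) (a b : V) (r : ℕ) : Prop where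
  self : a = b → r = 0
  near : a ≠ b → a ∉ Y → b ∉ Y → NearSettled g D Y σ a b r
  left : a ∈ Y → b ∉ Y → FarSettled g D σ a b r
  right : a ∉ Y → b ∈ Y → FarSettled g D σ b a r
  far : a ≠ b → a ∈ Y → b ∈ Y → r = 2 * g + 2

lemma free_addEdge (u v : V) : free D Y (σ.addEdge u v) ⊆ free D Y σ := by
  intro w
  rw [mem_free, mem_free]
  exact fun H => ⟨H.1, (deg_mono ((Finset.subset_insert _ _).trans
    (Finset.subset_insert _ _)) w).trans_lt H.2⟩

lemma Valid.addEdge {u v : V} (H : Valid D m σ) (hu : u ∈ free D Y σ) (hv : v ∈ free D Y σ)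
    (huv : u ≠ v) : Valid D (m + 1) (σ.addEdge u v) where
  symm a b hab := by
    simp only [Adversary.addEdge, Finset.mem_insert, Prod.mk.injEq] at hab ⊢
    rcases hab with ⟨rfl, rfl⟩ | ⟨rfl, rfl⟩ | hab
    · simp
    · simp
    · exact Or.inr (Or.inr (H.symm _ _ hab))
  degE w := by
    have h1 := deg_insert_le (E := insert (v, u) σ.E) (u, v) w
    have h2 := deg_insert_le (E := σ.E) (v, u) w
    have h3 := (mem_free.1 hu).2
    have h4 := (mem_free.1 hv).2
    have h5 := H.degE w
    simp only at h1 h2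
    change deg (insert (u, v) (insert (v, u) σ.E)) w ≤ D
    by_cases huw : u = w
    · subst huw
      rw [if_pos rfl] at h1
      rw [if_neg huv.symm] at h2
      omega
    · rw [if_neg huw] at h1
      split_ifs at h2 with hvw
      · subst hvw
        omega
      · omega
  degK := H.degK
  cardE := by
    have h1 := Finset.card_insert_le (u, v) (insert (v, u) σ.E)
    have h2 := Finset.card_insert_le (v, u) σ.E
    have h3 := H.cardE
    change (insert (u, v) (insert (v, u) σ.E)).card ≤ _
    omega
  cardK := H.cardK.trans (Nat.le_succ m)

/-- New edges join free points and the free set only shrinks. Hence distances to it do not decrease,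
and the settling inequality persists. -/
lemma NearSettled.addEdge {u v a b : V} {r : ℕ} (hσ : Valid D m σ) (hu : u ∈ free D Y σ)
    (hv : v ∈ free D Y σ) (H : NearSettled g D Y σ a b r) :
    NearSettled g D Y (σ.addEdge u v) a b r := by
  have h1 : hop (g + 1) (σ.addEdge u v).E a b = hop (g + 1) σ.E a b :=
    hop_insert hσ.symm hu hv H.2
  have h2 := hopTo_le_insert (h := g) (E := σ.E) hu hv (free_addEdge u v) a
  have h3 := hopTo_le_insert (h := g) (E := σ.E) hu hv (free_addEdge u v) b
  exact ⟨by rw [h1]; exact H.1, by rw [h1]; exact H.2.trans (by gcongr <;> assumption)⟩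

lemma Settled.addEdge {u v a b : V} {r : ℕ} (hσ : Valid D m σ) (hu : u ∈ free D Y σ)
    (hv : v ∈ free D Y σ) (H : Settled g D Y σ a b r) : Settled g D Y (σ.addEdge u v) a b r :=
  ⟨H.self, fun h1 h2 h3 => (H.near h1 h2 h3).addEdge hσ hu hv, H.left, H.right, H.far⟩

lemma Settled.addPair {y x a b : V} {r : ℕ} (hy : deg σ.K y < D)
    (H : Settled g D Y σ a b r) : Settled g D Y (σ.addPair y x) a b r :=
  ⟨H.self, H.near, fun h1 h2 => (H.left h1 h2).addPair hy,
    fun h1 h2 => (H.right h1 h2).addPair hy, H.far⟩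

/-- If a detour through free points could still pay off, the adversary inserts the best one itself:
an edge between free points nearest to `a` and `b`. -/
lemma exists_nearSettled (hσ : Valid D m σ) (a b : V) :
    ∃ τ r, Valid D (m + 1) τ ∧ (∀ a b r, Settled g D Y σ a b r → Settled g D Y τ a b r) ∧
      NearSettled g D Y τ a b r := by
  by_cases hab : hop (g + 1) σ.E a b ≤
      1 + hopTo g σ.E (free D Y σ) a + hopTo g σ.E (free D Y σ) b
  · exact ⟨σ, _, hσ.mono (Nat.le_succ m), fun _ _ _ h => h, rfl, hab⟩
  have hg : hop (g + 1) σ.E a b ≤ g + 1 := hop_le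
  -- Since `hop` is capped at `g + 1`, the failed inequality puts both distances to the free set
  -- below their cap `g`, so they are attained.
  obtain ⟨u, hu, hau⟩ := (hopTo_le_iff.1 (le_refl (hopTo g σ.E (free D Y σ) a))).resolve_left
    (by omega)
  obtain ⟨v, hv, hbv⟩ := (hopTo_le_iff.1 (le_refl (hopTo g σ.E (free D Y σ) b))).resolve_left
    (by omega)
  have hvb := hbv.symm hσ.symm
  have huv : u ≠ v := by
    rintro rfl
    have : hop (g + 1) σ.E a b ≤ _ := hop_le_iff.2 (Or.inr (hau.trans hvb))
    omega
  refine ⟨σ.addEdge u v, _, hσ.addEdge hu hv huv, fun _ _ _ h => h.addEdge hσ hu hv, rfl, ?_⟩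
  have h2 := hopTo_le_insert (h := g) (E := σ.E) hu hv (free_addEdge u v) a
  have h3 := hopTo_le_insert (h := g) (E := σ.E) hu hv (free_addEdge u v) b
  have hE : σ.E ⊆ (σ.addEdge u v).E :=
    (Finset.subset_insert _ _).trans (Finset.subset_insert _ _)
  have h4 : hop (g + 1) (σ.addEdge u v).E a b ≤
      hopTo g σ.E (free D Y σ) a + 1 + hopTo g σ.E (free D Y σ) b :=
    hop_le_iff.2 (Or.inr (((hau.mono_left hE).trans (within_of_mem
      (Finset.mem_insert_self _ _))).trans (hvb.mono_left hE)))
  change _ ≤ hopTo g (σ.addEdge u v).E (free D Y (σ.addEdge u v)) a at h2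
  change _ ≤ hopTo g (σ.addEdge u v).E (free D Y (σ.addEdge u v)) b at h3
  omega

/-- A point `y` of the reserve with budget left answers 2g + 1, its later distance as a hub from
points far from its neighbours, and the pair is recorded. Once the budget is used up, `y` is no
candidate for the hub, and new partners get 2g + 2 without a record. -/
lemma exists_farSettled (hσ : Valid D m σ) (y x : V) :
    ∃ τ r, Valid D (m + 1) τ ∧ (∀ a b r, Settled g D Y σ a b r → Settled g D Y τ a b r) ∧
      FarSettled g D τ y x r := by
  by_cases hK : (y, x) ∈ σ.K
  · exact ⟨σ, _, hσ.mono (Nat.le_succ m), fun _ _ _ h => h, Or.inl ⟨hK, rfl⟩⟩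
  by_cases hD : D ≤ deg σ.K y
  · exact ⟨σ, _, hσ.mono (Nat.le_succ m), fun _ _ _ h => h, Or.inr ⟨hK, hD, rfl⟩⟩
  · rw [not_le] at hD
    exact ⟨σ.addPair y x, _, hσ.addPair hD, fun _ _ _ h => h.addPair hD,
      Or.inl ⟨Finset.mem_insert_self _ _, rfl⟩⟩

lemma exists_settled (hσ : Valid D m σ) (a b : V) :
    ∃ τ r, Valid D (m + 1) τ ∧ (∀ a b r, Settled g D Y σ a b r → Settled g D Y τ a b r) ∧
      Settled g D Y τ a b r := by
  by_cases hab : a = b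
  · refine ⟨σ, 0, hσ.mono (Nat.le_succ m), fun _ _ _ h => h, ?_⟩
    constructor <;> grind
  by_cases ha : a ∈ Y <;> by_cases hb : b ∈ Y
  · refine ⟨σ, 2 * g + 2, hσ.mono (Nat.le_succ m), fun _ _ _ h => h, ?_⟩
    constructor <;> grind
  · obtain ⟨τ, r, h1, h2, h3⟩ := exists_farSettled (g := g) (Y := Y) hσ a b
    refine ⟨τ, r, h1, h2, ?_⟩
    constructor <;> grind
  · obtain ⟨τ, r, h1, h2, h3⟩ := exists_farSettled (g := g) (Y := Y) hσ b a
    refine ⟨τ, r, h1, h2, ?_⟩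
    constructor <;> grind
  · obtain ⟨τ, r, h1, h2, h3⟩ := exists_nearSettled (g := g) (Y := Y) hσ a b
    refine ⟨τ, r, h1, h2, ?_⟩
    constructor <;> grind

/-- The adversary can play against a strategy for `m` more queries. -/
lemma exists_play {n g D : ℕ} {Y : Finset (Fin n)} (T : QueryTree) :
    ∀ (m l : ℕ) (σ : Adversary (Fin n)), Valid D l σ → ∃ (τ : Adversary (Fin n)) (z : ℕ),
      Valid D (l + m) τ ∧ (∀ a b r, Settled g D Y σ a b r → Settled g D Y τ a b r) ∧
      ∀ d : Fin n → Fin n → ℝ, (∀ a b r, Settled g D Y τ a b r → d a b = r) →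
        T.queries (oracle d) ≤ m → T.run (oracle d) = z := by
  induction T with
  | output z =>
    exact fun m l σ hσ => ⟨σ, z, hσ.mono (Nat.le_add_right l m), fun _ _ _ h => h,
      fun _ _ _ => rfl⟩
  | query a b next ih =>
    intro m l σ hσ
    obtain _ | m := m
    · refine ⟨σ, 0, hσ, fun _ _ _ h => h, fun d _ h => ?_⟩
      simp [QueryTree.queries] at h
    by_cases hab : a < n ∧ b < n
    · obtain ⟨τ, r, h1, h2, h3⟩ := exists_settled (g := g) (Y := Y) hσ ⟨a, hab.1⟩ ⟨b, hab.2⟩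
      obtain ⟨υ, z, h4, h5, h6⟩ := ih r m (l + 1) τ h1
      refine ⟨υ, z, by rwa [show l + (m + 1) = l + 1 + m by ring],
        fun a b r h => h5 _ _ _ (h2 _ _ _ h), fun d hd hq => ?_⟩
      have hr : oracle d a b = r := by
        rw [oracle, dif_pos hab]
        exact hd _ _ _ (h5 _ _ _ h3)
      rw [QueryTree.queries, hr] at hq
      rw [QueryTree.run, hr]
      exact h6 d hd (by omega)
    · obtain ⟨υ, z, h4, h5, h6⟩ := ih 0 m l σ hσ
      refine ⟨υ, z, h4.mono (by omega), h5, fun d hd hq => ?_⟩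
      have hr : oracle d a b = 0 := by rw [oracle, dif_neg hab]
      rw [QueryTree.queries, hr] at hq
      rw [QueryTree.run, hr]
      exact h6 d hd (by omega)

end Adversary

/-! ### The final metric -/

namespace Adversary

variable {V : Type*} [DecidableEq V] {g : ℕ} {Y N : Finset V} {σ : Adversary V} {y : V}

/-- The metric with which the adversary ends: the point `y` of the reserve becomes a neighbour, at
distance `1`, of the points in `N`. -/
def finalDist (g : ℕ) (Y : Finset V) (σ : Adversary V) (y : V) (N : Finset V) (a b : V) : ℕ :=
  if a = b then 0
  else if a ∉ Y ∧ b ∉ Y then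
    -- The second term is the route through `y`, which uses two edges of length 1.
    min (2 * hop (g + 1) σ.E a b) (2 * hopTo g σ.E N a + 2 * hopTo g σ.E N b + 2)
  else if a = y ∧ b ∉ Y then 2 * hopTo g σ.E N b + 1
  else if a ∉ Y ∧ b = y then 2 * hopTo g σ.E N a + 1
  else if (a ∈ Y ∧ b ∉ Y ∧ (a, b) ∈ σ.K) ∨ (a ∉ Y ∧ b ∈ Y ∧ (b, a) ∈ σ.K) then 2 * g + 1
  else 2 * g + 2

lemma finalDist_self (a : V) : finalDist g Y σ y N a a = 0 := if_pos rfl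

lemma finalDist_near {a b : V} (hab : a ≠ b) (ha : a ∉ Y) (hb : b ∉ Y) :
    finalDist g Y σ y N a b =
      min (2 * hop (g + 1) σ.E a b) (2 * hopTo g σ.E N a + 2 * hopTo g σ.E N b + 2) := by
  rw [finalDist, if_neg hab, if_pos ⟨ha, hb⟩]

lemma finalDist_hub (hy : y ∈ Y) {b : V} (hb : b ∉ Y) :
    finalDist g Y σ y N y b = 2 * hopTo g σ.E N b + 1 := by
  have : y ≠ b := fun h => hb (h ▸ hy)
  rw [finalDist, if_neg this, if_neg fun h => h.1 hy, if_pos ⟨rfl, hb⟩]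

lemma finalDist_symm (hE : ∀ a b, (a, b) ∈ σ.E → (b, a) ∈ σ.E) (a b : V) :
    finalDist g Y σ y N a b = finalDist g Y σ y N b a := by
  simp only [finalDist, hop_symm hE a b]
  split_ifs <;> first | omega | grind

lemma finalDist_le (a b : V) : finalDist g Y σ y N a b ≤ 2 * g + 2 := by
  have h1 : hop (g + 1) σ.E a b ≤ g + 1 := hop_le
  have h2 : hopTo g σ.E N a ≤ g := hopTo_le
  have h3 : hopTo g σ.E N b ≤ g := hopTo_le
  rw [finalDist]
  split_ifs <;> omega

lemma finalDist_pos {a b : V} (hab : a ≠ b) : 1 ≤ finalDist g Y σ y N a b := by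
  have h1 : 1 ≤ hop (g + 1) σ.E a b := hop_pos (by omega) hab
  rw [finalDist, if_neg hab]
  split_ifs <;> omega

lemma le_finalDist {a b : V} (hab : a ≠ b) (ha : a ∈ Y) (hay : a ≠ y) :
    2 * g + 1 ≤ finalDist g Y σ y N a b := by
  rw [finalDist, if_neg hab]
  split_ifs <;> first | omega | grind

/-- Points of the reserve other than `y` are at distance at least 2g + 1 from all others. As all
distances are at most 2g + 2 and positive ones at least 1, triples with such a point are harmless.
The others reduce to the triangle inequalities for `hop` and `hopTo`. -/
lemma finalDist_triangle (hE : ∀ a b, (a, b) ∈ σ.E → (b, a) ∈ σ.E) (hy : y ∈ Y) (a b c : V) :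
    finalDist g Y σ y N a c ≤ finalDist g Y σ y N a b + finalDist g Y σ y N b c := by
  by_cases hab : a = b
  · subst hab; rw [finalDist_self]; omega
  by_cases hbc : b = c
  · subst hbc; rw [finalDist_self]; omega
  by_cases hac : a = c
  · subst hac; rw [finalDist_self]; omega
  have hle : finalDist g Y σ y N a c ≤ 2 * g + 2 := finalDist_le _ _
  have h1 : 1 ≤ finalDist g Y σ y N a b := finalDist_pos hab
  have h2 : 1 ≤ finalDist g Y σ y N b c := finalDist_pos hbc
  by_cases ha : a ∈ Y ∧ a ≠ y
  · have : 2 * g + 1 ≤ finalDist g Y σ y N a b := le_finalDist hab ha.1 ha.2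
    omega
  by_cases hb : b ∈ Y ∧ b ≠ y
  · have : 2 * g + 1 ≤ finalDist g Y σ y N b c := le_finalDist hbc hb.1 hb.2
    omega
  by_cases hc : c ∈ Y ∧ c ≠ y
  · have : 2 * g + 1 ≤ finalDist g Y σ y N c b := le_finalDist (Ne.symm hbc) hc.1 hc.2
    rw [finalDist_symm hE c b] at this
    omega
  have h3 : hop (g + 1) σ.E a c ≤ hop (g + 1) σ.E a b + hop (g + 1) σ.E b c := hop_triangle a b c
  have hs : ∀ a b, hop (g + 1) σ.E a b = hop (g + 1) σ.E b a := hop_symm hE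
  have h4 : ∀ a b, hopTo g σ.E N a ≤ hop (g + 1) σ.E a b + hopTo g σ.E N b :=
    hopTo_triangle (Nat.le_succ g)
  have h5 : ∀ a, a ∉ Y → finalDist g Y σ y N a y = 2 * hopTo g σ.E N a + 1 := fun a ha => by
    rw [finalDist_symm hE, finalDist_hub hy ha]
  have h6 : ∀ a, ¬ (a ∈ Y ∧ a ≠ y) → a = y ∨ a ∉ Y := by
    intro a ha
    tauto
  rcases h6 a ha with rfl | ha'
  · have hb' : b ∉ Y := (h6 b hb).resolve_left (Ne.symm hab)
    have hc' : c ∉ Y := (h6 c hc).resolve_left (Ne.symm hac)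
    rw [finalDist_hub hy hb', finalDist_hub hy hc', finalDist_near hbc hb' hc']
    have := h4 c b
    have := hs b c
    omega
  rcases h6 c hc with rfl | hc'
  · have hb' : b ∉ Y := (h6 b hb).resolve_left hbc
    rw [h5 a ha', h5 b hb', finalDist_near hab ha' hb']
    have := h4 a b
    omega
  rw [finalDist_near hac ha' hc']
  rcases h6 b hb with rfl | hb'
  · rw [h5 a ha', finalDist_hub hy hc']
    omega
  · rw [finalDist_near hab ha' hb', finalDist_near hbc hb' hc']
    have := h4 a b
    have := h4 c b
    have := hs b c
    omega

lemma isMetric_finalDist {n : ℕ} {Y N : Finset (Fin n)} {σ : Adversary (Fin n)} {y : Fin n}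
    (hE : ∀ a b, (a, b) ∈ σ.E → (b, a) ∈ σ.E) (hy : y ∈ Y) :
    IsMetric fun a b => (finalDist g Y σ y N a b : ℝ) where
  nonneg _ _ := Nat.cast_nonneg _
  self a := by rw [finalDist_self, Nat.cast_zero]
  pos a b hab := Nat.cast_pos.2 (finalDist_pos hab)
  symm a b := by rw [finalDist_symm hE]
  triangle a b c := by exact_mod_cast finalDist_triangle hE hy a b c

variable [Fintype V] {D m : ℕ}

/-- The points which are free and not close to a point of `Q`. -/
def hubSet (g D : ℕ) (Y : Finset V) (σ : Adversary V) (Q : Finset V) : Finset V :=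
  open Classical in (free D Y σ).filter fun u => ∀ b ∈ Q, ¬ Within σ.E (g - 1) b u

lemma hubSet_subset (Q : Finset V) : hubSet g D Y σ Q ⊆ free D Y σ := by
  classical exact Finset.filter_subset _ _

/-- Excluding balls of radius g - 1 leaves hub points at least g hops away, and g is the cap. So `y`
has distance 2g + 1 from the points of `Q` outside the reserve, as was answered. -/
lemma hopTo_hubSet {Q : Finset V} (hg : 1 ≤ g) {b : V} (hb : b ∈ Q) :
    hopTo g σ.E (hubSet g D Y σ Q) b = g := by
  classical
  refine le_antisymm hopTo_le ?_
  by_contra! h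
  rcases hopTo_le_iff.1 (Nat.le_sub_one_of_lt h) with h | ⟨u, hu, h⟩
  · omega
  · exact (Finset.mem_filter.1 hu).2 b hb h

/-- The final metric is consistent with all fixed distances. -/
lemma Settled.finalDist_eq {Q : Finset V} (hE : ∀ a b, (a, b) ∈ σ.E → (b, a) ∈ σ.E) (hg : 1 ≤ g)
    (hy : y ∈ Y) (hyD : deg σ.K y < D) (hQ : ∀ b, (y, b) ∈ σ.K → b ∈ Q) {a b : V} {r : ℕ}
    (H : Settled g D Y σ a b r) : finalDist g Y σ y (hubSet g D Y σ Q) a b = r := by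
  classical
  have far : ∀ a b, a ∈ Y → b ∉ Y → FarSettled g D σ a b r →
      finalDist g Y σ y (hubSet g D Y σ Q) a b = r := by
    intro a b ha hb H
    by_cases hay : a = y
    · subst hay
      -- The budget of `y` is not used up, so only its recorded partners are settled, and these lie
      -- in `Q`.
      rcases H with ⟨h1, h2⟩ | ⟨h1, h2, h3⟩
      · rw [finalDist_hub hy hb, hopTo_hubSet hg (hQ b h1), h2]
      · omega
    · have hab : a ≠ b := fun h => hb (h ▸ ha)
      rw [finalDist, if_neg hab, if_neg fun h => h.1 ha, if_neg fun h => hay h.1,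
        if_neg fun h => h.1 ha]
      rcases H with ⟨h1, h2⟩ | ⟨h1, h2, h3⟩
      · rw [if_pos (Or.inl ⟨ha, hb, h1⟩), h2]
      · rw [if_neg (by rintro (h | h); exacts [h1 h.2.2, h.1 ha]), h3]
  by_cases hab : a = b
  · subst hab
    rw [finalDist_self, H.self rfl]
  by_cases ha : a ∈ Y <;> by_cases hb : b ∈ Y
  · rw [H.far hab ha hb, finalDist, if_neg hab, if_neg fun h => h.1 ha, if_neg fun h => h.2 hb,
      if_neg fun h => h.1 ha, if_neg (by rintro (h | h); exacts [h.2.1 hb, h.1 ha])]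
  · exact far a b ha hb (H.left ha hb)
  · rw [finalDist_symm hE]
    exact far b a hb ha (H.right ha hb)
  · obtain ⟨h1, h2⟩ := H.near hab ha hb
    rw [finalDist_near hab ha hb, h1]
    -- Hub points are free, so the settling inequality makes the route through `y` no shorter than
    -- twice the hop distance.
    have hsub : hubSet g D Y σ Q ⊆ free D Y σ := hubSet_subset Q
    have h3 := hopTo_anti (h := g) (E := σ.E) hsub a
    have h4 := hopTo_anti (h := g) (E := σ.E) hsub b
    omega

/-- Few points are not in the hub set. -/
lemma Valid.card_compl_hubSet_le (H : Valid D m σ) (hg : 1 ≤ g) {Q : Finset V}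
    (hQ : Q.card ≤ D + 1) : ∃ s, s * D ≤ 2 * m ∧
      (Finset.univ.filter fun u => u ∉ hubSet g D Y σ Q).card ≤ Y.card + s + (D + 1) ^ g := by
  classical
  refine ⟨(Finset.univ.filter fun u => D ≤ deg σ.E u).card,
    (card_mul_le_of_le_deg fun u hu => (Finset.mem_filter.1 hu).2).trans H.cardE, ?_⟩
  have hsub : (Finset.univ.filter fun u => u ∉ hubSet g D Y σ Q) ⊆
      Y ∪ (Finset.univ.filter fun u => D ≤ deg σ.E u) ∪
      Q.biUnion fun b => Finset.univ.filter fun u => Within σ.E (g - 1) b u := by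
    intro u hu
    by_contra hu'
    simp only [Finset.mem_union, Finset.mem_filter, Finset.mem_biUnion, not_or, not_exists,
      Finset.mem_univ, true_and, not_and, not_le] at hu'
    exact (Finset.mem_filter.1 hu).2 (Finset.mem_filter.2 ⟨mem_free.2 hu'.1, hu'.2⟩)
  have h1 := Finset.card_biUnion_le_card_mul Q
    (fun b => Finset.univ.filter fun u => Within σ.E (g - 1) b u) _
    fun b _ => card_ball_le H.degE b (g - 1)
  have h2 : Q.card * (D + 1) ^ (g - 1) ≤ (D + 1) ^ g := by
    calc _ ≤ (D + 1) * (D + 1) ^ (g - 1) := Nat.mul_le_mul_right _ hQ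
      _ = (D + 1) ^ g := by rw [← pow_succ']; congr 1; omega
  refine (Finset.card_le_card hsub).trans ((Finset.card_union_le _ _).trans ?_)
  have h3 := Finset.card_union_le Y (Finset.univ.filter fun u => D ≤ deg σ.E u)
  omega

/-- Few points are close to the output `z`. -/
lemma Valid.card_close_le (H : Valid D m σ) (hg : 1 ≤ g) {z : V} (hzy : z ≠ y)
    (hz : hopTo g σ.E N z = g) :
    (Finset.univ.filter fun x => finalDist g Y σ y N z x < 2 * g + 2).card ≤
      Y.card + (D + 1) ^ g := by
  classical
  by_cases hzY : z ∈ Y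
  · have hsub : (Finset.univ.filter fun x => finalDist g Y σ y N z x < 2 * g + 2) ⊆
        Y ∪ Finset.univ.filter fun x => (z, x) ∈ σ.K := by
      intro x hx
      by_contra hx'
      simp only [Finset.mem_union, Finset.mem_filter, Finset.mem_univ, true_and, not_or] at hx hx'
      have hzx : z ≠ x := fun h => hx'.1 (h ▸ hzY)
      rw [finalDist, if_neg hzx, if_neg fun h => h.1 hzY, if_neg fun h => hzy h.1,
        if_neg fun h => h.1 hzY, if_neg (by rintro (h | h); exacts [hx'.2 h.2.2, h.1 hzY])] at hx
      omega
    refine (Finset.card_le_card hsub).trans ((Finset.card_union_le _ _).trans ?_)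
    have h1 := (card_neighbors_le σ.K z).trans (H.degK z)
    have h2 : (D + 1) ^ 1 ≤ (D + 1) ^ g := Nat.pow_le_pow_right (by omega) hg
    rw [pow_one] at h2
    omega
  · have hsub : (Finset.univ.filter fun x => finalDist g Y σ y N z x < 2 * g + 2) ⊆
        Y ∪ Finset.univ.filter fun x => Within σ.E g z x := by
      intro x hx
      by_contra hx'
      simp only [Finset.mem_union, Finset.mem_filter, Finset.mem_univ, true_and, not_or] at hx hx'
      have hzx : z ≠ x := fun h => hx'.2 (h ▸ within_refl _ _ _)
      -- The route through `y` has length at least 2g + 2, so only the hop distance can make `x`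
      -- close.
      rw [finalDist_near hzx hzY hx'.1, hz] at hx
      have h1 : hop (g + 1) σ.E z x ≤ g := by omega
      rcases hop_le_iff.1 h1 with h | h
      · omega
      · exact hx'.2 h
    refine (Finset.card_le_card hsub).trans ((Finset.card_union_le _ _).trans ?_)
    have h1 := card_ball_le H.degE z g
    omega

end Adversary

/-! ### Counting and the lower bound -/

open Adversary in
/-- Against every strategy with at most `m` queries, the adversary has a metric for which the
approximation ratio is bad. -/
theorem exists_metric_of_queries_le {n g D m : ℕ} (hg : 1 ≤ g) (Y : Finset (Fin n))
    (hY : m + D < Y.card * D) (T : QueryTree) :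
    ∃ d : Fin n → Fin n → ℝ, IsMetric d ∧ (T.queries (oracle d) ≤ m → ∀ c : ℝ, 0 ≤ c →
      IsApproxOutput c d (T.run (oracle d)) → ∃ s : ℕ, s * D ≤ 2 * m ∧
      (2 * g + 2) * ((n : ℝ) - (Y.card + (D + 1) ^ g)) ≤
        c * (n + (2 * g + 2) * (Y.card + s + (D + 1) ^ g))) := by
  classical
  obtain ⟨σ, z, hσ, -, hd⟩ := exists_play (g := g) (D := D) (Y := Y) T m 0 ⟨∅, ∅⟩
    ⟨by simp, by simp [deg], by simp [deg], by simp, by simp⟩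
  rw [Nat.zero_add] at hσ
  -- At least two points of the reserve have budget left, as otherwise `(Y.card - 1) * D ≤ m`. One
  -- of them is not the output.
  obtain ⟨y, hy, hyz⟩ : ∃ y ∈ Y.filter (fun y => deg σ.K y < D), (y : ℕ) ≠ z := by
    have h1 := (card_mul_le_of_le_deg (E := σ.K) (D := D)
      (S := Y.filter fun y => ¬ deg σ.K y < D)
      fun u hu => not_lt.1 (Finset.mem_filter.1 hu).2).trans hσ.cardK
    have h2 := Finset.card_filter_add_card_filter_not (s := Y) fun y => deg σ.K y < D
    have h3 : 1 < (Y.filter fun y => deg σ.K y < D).card := by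
      by_contra! h
      rw [← h2, add_mul] at hY
      have := Nat.mul_le_mul_right D h
      omega
    obtain ⟨u, hu, v, hv, huv⟩ := Finset.one_lt_card.1 h3
    by_cases huz : (u : ℕ) = z
    · exact ⟨v, hv, fun h => huv (Fin.ext (huz.trans h.symm))⟩
    · exact ⟨u, hu, huz⟩
  obtain ⟨hyY, hyD⟩ := Finset.mem_filter.1 hy
  -- The output is put into `Q` in order to keep it far from the hub's neighbours.
  let Q : Finset (Fin n) := Finset.univ.filter fun b => (y, b) ∈ σ.K ∨ (b : ℕ) = z
  have hQ : Q.card ≤ D + 1 := by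
    have h1 := (card_neighbors_le σ.K y).trans (hσ.degK y)
    have h2 : (Finset.univ.filter fun b : Fin n => (b : ℕ) = z).card ≤ 1 :=
      Finset.card_le_one.2 fun a ha b hb => Fin.ext <|
        (Finset.mem_filter.1 ha).2.trans (Finset.mem_filter.1 hb).2.symm
    simp only [Q, Finset.filter_or]
    exact (Finset.card_union_le _ _).trans (Nat.add_le_add h1 h2)
  let δ := finalDist g Y σ y (hubSet g D Y σ Q)
  refine ⟨fun a b => (δ a b : ℝ), isMetric_finalDist hσ.symm hyY, fun hq c hc hz => ?_⟩
  rw [hd _ (fun a b r H => by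
    exact congrArg Nat.cast
      (H.finalDist_eq hσ.symm hg hyY hyD fun b hb => by simp [Q, hb])) hq] at hz
  obtain ⟨z, rfl, hz⟩ := hz
  obtain ⟨s, hs, hN⟩ := hσ.card_compl_hubSet_le (Y := Y) hg hQ
  refine ⟨s, hs, ?_⟩
  have hclose := hσ.card_close_le (Y := Y) (y := y) hg (fun h => hyz (by rw [h]))
    (hopTo_hubSet (D := D) (Y := Y) (σ := σ) hg (by simp [Q] : z ∈ Q))
  have hlow : (2 * g + 2) * n ≤ ∑ x, δ z x + (2 * g + 2) * (Y.card + (D + 1) ^ g) := by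
    have h1 : ∑ x : Fin n, (2 * g + 2) ≤
        ∑ x, (δ z x + if δ z x < 2 * g + 2 then 2 * g + 2 else 0) :=
      Finset.sum_le_sum fun x _ => by split_ifs <;> omega
    rw [Finset.sum_const, Finset.sum_add_distrib, ← Finset.sum_filter, Finset.sum_const] at h1
    simp only [Finset.card_univ, Fintype.card_fin, smul_eq_mul] at h1
    have h2 := Nat.mul_le_mul_left (2 * g + 2) hclose
    rw [mul_comm (Finset.card _)] at h1
    rw [mul_comm] at h1
    exact h1.trans (Nat.add_le_add_left h2 _)
  have hup : ∑ x, δ y x ≤ n + (2 * g + 2) * (Y.card + s + (D + 1) ^ g) := by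
    have h1 : ∑ x, δ y x ≤
        ∑ x : Fin n, (1 + if x ∉ hubSet g D Y σ Q then 2 * g + 2 else 0) := by
      refine Finset.sum_le_sum fun x _ => ?_
      by_cases h : x ∉ hubSet g D Y σ Q
      · rw [if_pos h]
        exact (finalDist_le _ _).trans (Nat.le_add_left _ _)
      · rw [if_neg h]
        rw [not_not] at h
        have hx : x ∉ Y := (mem_free.1 (hubSet_subset Q h)).1
        simp only [δ]
        rw [finalDist_hub hyY hx, hopTo_of_mem h]
    rw [Finset.sum_add_distrib, ← Finset.sum_filter, Finset.sum_const, Finset.sum_const] at h1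
    simp only [Finset.card_univ, Fintype.card_fin, smul_eq_mul, mul_one] at h1
    have h2 := Nat.mul_le_mul_left (2 * g + 2) hN
    rw [mul_comm (Finset.card _)] at h1
    exact h1.trans (Nat.add_le_add_left h2 _)
  have hlow' : ((2 * g + 2) * n : ℝ) ≤
      ∑ x, (δ z x : ℝ) + (2 * g + 2) * (Y.card + (D + 1) ^ g) := by exact_mod_cast hlow
  have hup' : ∑ x, (δ y x : ℝ) ≤ n + (2 * g + 2) * (Y.card + s + (D + 1) ^ g) := by
    exact_mod_cast hup
  have := (hz y).trans (mul_le_mul_of_nonneg_left hup' hc)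
  linarith

/-- The lower bound on the approximation ratio. -/
theorem le_of_hasQueryStrategy {g : ℕ} (hg : 1 ≤ g) {ε c : ℝ} (hε : 0 < ε) (hεg : ε * g < 1) (hc : 0 ≤ c)
    (H : HasQueryStrategy (1 + ε) c) : 2 * (g : ℝ) + 2 ≤ c := by
  by_contra! hcg
  obtain ⟨A, q, hA, hq, hO⟩ := H
  obtain ⟨C, hC, hO⟩ := hO.exists_pos
  have hg0 : (0 : ℝ) < g := by exact_mod_cast hg
  -- With D ≈ n^β, `ε < β` makes n^(1+ε)/D = o(n) and `β * g < 1` makes (D + 1)^g = o(n).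
  obtain ⟨β, hεβ, hβg⟩ : ∃ β, ε < β ∧ β * g < 1 := by
    obtain ⟨β, h1, h2⟩ := exists_between ((lt_div_iff₀ hg0).2 hεg)
    exact ⟨β, h1, (lt_div_iff₀ hg0).1 h2⟩
  -- `3 * η` pays for the reserve, the exhausted points and the balls in the cost of `y`; `2 * η`
  -- pays for the reserve and a ball in the cost of the output.
  obtain ⟨η, hη0, hη1, hη⟩ : ∃ η : ℝ, 0 < η ∧ η < 1 ∧
      c * (1 + (2 * g + 2) * (3 * η)) < (2 * g + 2) * (1 - 2 * η) := by
    have hM : 0 < (2 * (g : ℝ) + 2) * 2 + c * ((2 * g + 2) * 3) := by positivity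
    refine ⟨min (1 / 2) ((2 * g + 2 - c) / (2 * ((2 * (g : ℝ) + 2) * 2 + c * ((2 * g + 2) * 3)))),
      lt_min (by norm_num) (div_pos (by linarith) (by positivity)),
      (min_le_left _ _).trans_lt (by norm_num), ?_⟩
    have h1 := min_le_right (1 / 2 : ℝ)
      ((2 * g + 2 - c) / (2 * ((2 * (g : ℝ) + 2) * 2 + c * ((2 * g + 2) * 3))))
    rw [le_div_iff₀ (by positivity)] at h1
    linarith
  have hpow : ∀ e : ℝ, 0 < e → ∀ M : ℝ, ∀ᶠ n : ℕ in atTop, M ≤ (n : ℝ) ^ e := fun e he M =>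
    ((tendsto_rpow_atTop he).comp tendsto_natCast_atTop_atTop).eventually_ge_atTop M
  obtain ⟨n, hn1, hn2, hn3, hn4, hn5⟩ := (hO.bound.and ((hpow (β - ε) (by linarith)
    (4 * C / η)).and ((hpow (1 - β * g) (by linarith) (3 ^ g / η)).and
    ((tendsto_natCast_atTop_atTop.eventually_ge_atTop (4 / η)).and
    (eventually_ge_atTop 1))))).exists
  have hn : (1 : ℝ) ≤ n := by exact_mod_cast hn5
  have hn0 : (0 : ℝ) < n := by linarith
  have hβ1 : 1 ≤ (n : ℝ) ^ β := Real.one_le_rpow hn (by linarith)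
  obtain ⟨D, hD⟩ : ∃ D, D = ⌈(n : ℝ) ^ β⌉₊ := ⟨_, rfl⟩
  have hD1 : (n : ℝ) ^ β ≤ D := hD ▸ Nat.le_ceil _
  have hD2 : (D : ℝ) + 1 ≤ 3 * (n : ℝ) ^ β := by
    have := Nat.ceil_lt_add_one (by linarith : 0 ≤ (n : ℝ) ^ β)
    rw [← hD] at this
    linarith
  have hDpos : (0 : ℝ) < D := by linarith
  have hball : ((D : ℝ) + 1) ^ g ≤ η * n := by
    calc ((D : ℝ) + 1) ^ g ≤ (3 * (n : ℝ) ^ β) ^ g := pow_le_pow_left₀ (by positivity) hD2 g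
      _ = 3 ^ g * (n : ℝ) ^ (β * g) := by rw [mul_pow, Real.rpow_mul hn0.le, Real.rpow_natCast]
      _ ≤ (n : ℝ) ^ (1 - β * g) * η * (n : ℝ) ^ (β * g) := by
          gcongr
          exact (div_le_iff₀ hη0).1 hn3
      _ = η * ((n : ℝ) ^ (1 - β * g) * (n : ℝ) ^ (β * g)) := by ring
      _ = η * n := by rw [← Real.rpow_add hn0, sub_add_cancel, Real.rpow_one]
  have hqn : 4 * (q n : ℝ) ≤ η * n * D := by
    rw [Real.norm_of_nonneg (by positivity), Real.norm_of_nonneg (by positivity)] at hn1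
    calc 4 * (q n : ℝ) ≤ 4 * C * (n : ℝ) ^ (1 + ε) := by linarith
      _ ≤ (n : ℝ) ^ (β - ε) * η * (n : ℝ) ^ (1 + ε) := by
          exact mul_le_mul_of_nonneg_right ((div_le_iff₀ hη0).1 hn2) (by positivity)
      _ = η * ((n : ℝ) ^ (β - ε) * (n : ℝ) ^ (1 + ε)) := by ring
      _ = η * n * (n : ℝ) ^ β := by
          rw [← Real.rpow_add hn0, show β - ε + (1 + ε) = 1 + β by ring, Real.rpow_add hn0,
            Real.rpow_one]
          ring
      _ ≤ η * n * D := by gcongr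
  have hηn : 4 ≤ η * n := by rw [mul_comm]; exact (div_le_iff₀ hη0).1 hn4
  have hYn : ⌊η * n⌋₊ ≤ (Finset.univ : Finset (Fin n)).card := by
    rw [Finset.card_univ, Fintype.card_fin]
    refine Nat.floor_le_of_le ?_
    nlinarith
  obtain ⟨Y, -, hY⟩ := Finset.exists_subset_card_eq hYn
  have hY1 : (Y.card : ℝ) ≤ η * n := hY ▸ Nat.floor_le (by positivity)
  have hY2 : η * n < Y.card + 1 := hY ▸ Nat.lt_floor_add_one _
  have hYD : q n + D < Y.card * D := by
    -- From 4q ≤ ηnD and ηn ≥ 4 follows q + D < (ηn - 1)D, where ηn - 1 is less than the size of the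
    -- reserve.
    have : (q n : ℝ) + D < Y.card * D := by nlinarith
    exact_mod_cast this
  obtain ⟨d, hd, h⟩ := exists_metric_of_queries_le hg Y hYD (A n)
  obtain ⟨s, hs, h⟩ := h (hq n hn5 d hd) c hc (hA n hn5 d hd)
  have hs' : (s : ℝ) ≤ η * n := by
    have h1 : (s : ℝ) * D ≤ 2 * q n := by exact_mod_cast hs
    refine le_of_mul_le_mul_right (a := (D : ℝ)) ?_ hDpos
    have : (0 : ℝ) ≤ q n := Nat.cast_nonneg _
    linarith
  have h2 : c * (n + (2 * g + 2) * (Y.card + s + (D + 1) ^ g)) ≤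
      c * (1 + (2 * g + 2) * (3 * η)) * n := by
    rw [mul_assoc c, add_mul 1, one_mul, mul_assoc (2 * (g : ℝ) + 2)]
    gcongr
    linarith
  have h3 : (2 * g + 2) * (1 - 2 * η) * n ≤
      (2 * g + 2) * ((n : ℝ) - (Y.card + (D + 1) ^ g)) := by
    rw [mul_assoc]
    gcongr
    linarith
  have h4 := mul_lt_mul_of_pos_right hη hn0
  linarith

end MetricMedian

end

/-! ### The three minima -/

theorem theorem2 (ε : ℝ) (hε0 : 0 < ε) (hε1 : ε < 1) :
    IsLeast {c : ℝ | 1 ≤ c ∧ MetricMedian.HasQueryAlgorithm (1 + ε) c} (2 * (⌈1 / ε⌉ : ℝ)) ∧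
    IsLeast {c : ℝ | 1 ≤ c ∧ MetricMedian.HasTimeAlgorithm (1 + ε) c} (2 * (⌈1 / ε⌉ : ℝ)) ∧
    IsLeast {c : ℝ | 1 ≤ c ∧ MetricMedian.HasQueryStrategy (1 + ε) c} (2 * (⌈1 / ε⌉ : ℝ)) := by
  -- Here `ε < 1` enters: it gives `1 ≤ g`, without which the adversary has no room.
  have h1 : (1 : ℤ) < ⌈1 / ε⌉ := Int.lt_ceil.2 (by rw [Int.cast_one]; exact one_lt_one_div hε0 hε1)
  obtain ⟨g, hg⟩ : ∃ g : ℕ, ⌈1 / ε⌉ = g + 1 := ⟨(⌈1 / ε⌉ - 1).toNat, by omega⟩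
  have hg1 : 1 ≤ g := by omega
  have hg0 : (0 : ℝ) < g := by exact_mod_cast hg1
  have hεg : ε * g < 1 := by
    have h2 := Int.ceil_lt_add_one (1 / ε)
    rw [hg] at h2
    push_cast at h2
    rw [← lt_div_iff₀' hε0]
    linarith
  have hε : 1 / ((g + 1 : ℕ) : ℝ) ≤ ε := by
    have h2 := Int.le_ceil (1 / ε)
    rw [hg] at h2
    push_cast at h2 ⊢
    exact (one_div_le hε0 (by positivity)).1 h2
  have hT := MetricMedian.hasTimeAlgorithm (Nat.le_add_left 1 g) hε
  have hc : 2 * (⌈1 / ε⌉ : ℝ) = 2 * ((g + 1 : ℕ) : ℝ) := by rw [hg]; push_cast; rfl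
  have h1c : 1 ≤ 2 * ((g + 1 : ℕ) : ℝ) := by push_cast; linarith
  have lower : ∀ c : ℝ, 1 ≤ c → MetricMedian.HasQueryStrategy (1 + ε) c →
      2 * ((g + 1 : ℕ) : ℝ) ≤ c := by
    intro c hc H
    have := MetricMedian.le_of_hasQueryStrategy hg1 hε0 hεg (by linarith) H
    push_cast
    linarith
  rw [hc]
  exact ⟨⟨⟨h1c, hT.hasQueryAlgorithm⟩, fun c hc => lower c hc.1 hc.2.hasQueryStrategy⟩,
    ⟨⟨h1c, hT⟩, fun c hc => lower c hc.1 hc.2.hasQueryAlgorithm.hasQueryStrategy⟩,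
    ⟨⟨h1c, hT.hasQueryAlgorithm.hasQueryStrategy⟩, fun c hc => lower c hc.1 hc.2⟩⟩
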